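/- Let $\Sigma=\mathbb N^{\infty}$ be the space of sequences $\omega=\omega_1\omega_2\dots$ over the countably infinite alphabet $\mathbb N$, with the shift $\sigma$; for a finite word $w$ let $[w]\subset\Sigma$ be the set of sequences beginning with $w$. Let $X$ be a non-empty compact metric space and let $f_i:X\to X$ ($i\in\mathbb N$) satisfy $d(f_i(x),f_i(y))\le s\,d(x,y)$ with one constant $s<1$. For $w=w_1\dots w_n$ put $f_w=f_{w_1}\circ\dots\circ f_{w_n}$ (the identity if $w$ is empty), and let $\pi(\omega)$ be the single point of $\bigcap_{n\ge1}f_{\omega_1\dots\omega_n}(X)$. Let $\phi^{(i)}:X\to\mathbb R$ ($i\in\mathbb N$) be continuous with $\sup_{x\in X}\sum_i e^{\phi^{(i)}(x)}<\infty$, and let $\phi:\Sigma\to\mathbb R$, $\phi(\omega)=\phi^{(\omega_1)}(\pi(\sigma\omega))$. Assume that $\phi$ is Hölder continuous of some order $\beta>0$, i.e. $\sup_{n\ge1}e^{\beta n}\sup\{|\phi(x)-\phi(y)|:x_1=y_1,\dots,x_n=y_n\}<\infty$. The topological pressure of $\phi$ is $$P(\phi)=\lim_{n\to\infty}\frac1n\log\sum_{|w|=n}\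 \sup_{\tau\in[w]}\exp\Big(\sum_{j=0}^{n-1}\phi(\sigma^j\tau)\Big).$$ For $w=w_1\dots w_n$ let $S_w(\phi)=\sum_{j=1}^{n}\phi^{(w_j)}\circ f_{w_{j+1}\dots w_n}$. Let $m_\phi$ denote a Borel probability measure on $X$ such that, for $L g(x)=\sum_i e^{\phi^{(i)}(x)}g(f_i(x))$, one has $\int Lg\,dm_\phi=\lambda\int g\,dm_\phi$ for all $g\in C(X)$, where $\lambda=\int L1\,dm_\phi$. Let $\tilde m_\phi$ denote the Borel probability measure on $\Sigma$ with $\tilde m_\phi([w])=\int\exp(S_w(\phi)-P(\phi)|w|)\,dm_\phi$ for all finite words $w$, and let $\tilde\mu_\phi$ denote the $\sigma$-invariant probability measure on $\Sigma$ that is absolutely continuous with respect to $\tilde m_\phi$ and ergodic for every iterate $\sigma^n$, $n\ge1$. Theorem. Suppose that $$\sum_{i\in\mathbb N}\inf\big(-\phi|_{[i]}\big)\exp\big(\inf\phi|_{[i]}\big)<\infty .$$ Then the limit defining $P(\phi)$ exists and is finite, a measure $\tilde\mu_\phi$ as above exists, and every such measure $\tilde\mu_\phi$ satisfies $\int-\phi\,d\tilde\mu_\phi<\infty$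 (so that $\phi$ is $\tilde\mu_\phi$-integrable, $\phi$ being bounded above) and is an equilibrium state of $\phi$: $$h_{\tilde\mu_\phi}(\sigma)+\int\phi\,d\tilde\mu_\phi=P(\phi),$$ where $h_{\tilde\mu_\phi}(\sigma)$ is the Kolmogorov–Sinai entropy. -/

import Mathlib

open MeasureTheory Filter Topology Set
open scoped NNReal ENNReal

namespace CountableShift

/-! ### The full shift on countably many symbols

The alphabet is `ℕ`, and a point of the shift space is a sequence `ω : ℕ → ℕ` (with the product
topology and the product sigma-algebra, which is its Borel sigma-algebra); its first coordinate is
`ω 0`. Finite words are lists. -/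

/-- The shift transformation, which cuts out the first coordinate. -/
def shift (ω : ℕ → ℕ) : ℕ → ℕ := fun k => ω (k + 1)

/-- The cylinder `[w]` of all sequences that begin with the word `w`. -/
def wordCylinder (w : List ℕ) : Set (ℕ → ℕ) := {ω | ∀ (k : ℕ) (hk : k < w.length), ω k = w[k]}

/-- The word made of the first `n` letters of `ω`. -/
def initialWord (ω : ℕ → ℕ) (n : ℕ) : List ℕ := (List.range n).map ω

/-- `V_n(φ)`: the supremum of `|φ x - φ y|` over the `x`, `y` that agree in the first `n`
coordinates. -/
noncomputable def variation (φ : (ℕ → ℕ) → ℝ) (n : ℕ) : ℝ≥0∞ :=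
  ⨆ (x : ℕ → ℕ) (y : ℕ → ℕ) (_ : ∀ k < n, x k = y k), ENNReal.ofReal |φ x - φ y|

/-- Hölder continuity of order `β`: `sup_{n ≥ 1} exp (β n) V_n(φ) < ∞`. -/
def IsHolder (β : ℝ) (φ : (ℕ → ℕ) → ℝ) : Prop :=
  (⨆ (n : ℕ) (_ : 1 ≤ n), ENNReal.ofReal (Real.exp (β * n)) * variation φ n) < ⊤

/-- The partition function
`Z_n(φ) = ∑_{|w| = n} sup_{τ ∈ [w]} exp (∑_{j < n} φ (σ^j τ))`. -/
noncomputable def partitionFunction (φ : (ℕ → ℕ) → ℝ) (n : ℕ) : ℝ≥0∞ :=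
  ∑' w : {w : List ℕ // w.length = n},
    ⨆ τ ∈ wordCylinder w.1, ENNReal.ofReal (Real.exp (∑ j ∈ Finset.range n, φ (shift^[j] τ)))

/-- The sequence `(1 / n) log Z_n(φ)`, with values in the extended reals. -/
noncomputable def pressureSeq (φ : (ℕ → ℕ) → ℝ) (n : ℕ) : EReal :=
  ENNReal.log (partitionFunction φ n) / (n : EReal)

/-- The topological pressure `P(φ)`, the limit of `(1 / n) log Z_n(φ)`. It is written as an upper
limit so as to make sense before the limit is known to exist and to be finite. -/
noncomputable def pressure (φ : (ℕ → ℕ) → ℝ) : ℝ :=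
  (limsup (pressureSeq φ) atTop).toReal

/-! ### Kolmogorov-Sinai entropy -/

/-- The Shannon entropy `-∑ μ(A) log μ(A)` of the finite partition into the fibres of `ξ`. -/
noncomputable def partitionEntropy {Ω ι : Type*} [MeasurableSpace Ω] [Fintype ι]
    (μ : Measure Ω) (ξ : Ω → ι) : ℝ :=
  ∑ a : ι, Real.negMulLog (μ.real (ξ ⁻¹' {a}))

/-- The map whose fibres are the atoms of the join `ξ ∨ T⁻¹ξ ∨ ⋯ ∨ T^{-(n-1)}ξ`. -/
def itinerary {Ω ι : Type*} (T : Ω → Ω) (ξ : Ω → ι) (n : ℕ) : Ω → (Fin n → ι) :=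
  fun x j => ξ (T^[j] x)

/-- The entropy `h_μ(T, ξ)` of `T` relative to a finite partition: the limit (for invariant `μ`) of
`(1 / n) H_μ(ξ ∨ ⋯ ∨ T^{-(n-1)}ξ)`. -/
noncomputable def relEntropy {Ω : Type*} [MeasurableSpace Ω] (T : Ω → Ω) (μ : Measure Ω)
    {k : ℕ} (ξ : Ω → Fin k) : EReal :=
  limsup (fun n : ℕ => ((partitionEntropy μ (itinerary T ξ n) / n : ℝ) : EReal)) atTop

/-- The Kolmogorov-Sinai entropy `h_μ(T)`: the supremum of `h_μ(T, ξ)` over all finite measurable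
partitions, a partition into at most `k` sets being given by a measurable map to `Fin k`. -/
noncomputable def ksEntropy {Ω : Type*} [MeasurableSpace Ω] (T : Ω → Ω) (μ : Measure Ω) : EReal :=
  ⨆ (k : ℕ) (ξ : Ω → Fin k) (_ : Measurable ξ), relEntropy T μ ξ

/-! ### Iterated function systems -/

section IFS

variable {X : Type*}

/-- `f_w = f_{w_1} ∘ ⋯ ∘ f_{w_n}`; the identity for the empty word. -/
def wordMap (f : ℕ → X → X) : List ℕ → X → X
  | [] => id
  | i :: w => f i ∘ wordMap f w

/-- The coding map `π`: the point of `⋂ n, f_{ω|n}(X)`. -/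
noncomputable def codingMap [Nonempty X] (f : ℕ → X → X) (ω : ℕ → ℕ) : X :=
  Classical.epsilon fun x => x ∈ ⋂ n : ℕ, range (wordMap f (initialWord ω n))

theorem wordMap_append (f : ℕ → X → X) (v w : List ℕ) :
    wordMap f (v ++ w) = wordMap f v ∘ wordMap f w := by
  induction v with
  | nil => rfl
  | cons i v ih => simp only [List.cons_append, wordMap, ih, Function.comp_assoc]

theorem initialWord_succ (ω : ℕ → ℕ) (n : ℕ) :
    initialWord ω (n + 1) = initialWord ω n ++ [ω n] := by
  simp [initialWord, List.range_succ]

/-- For uniform contractions of a compact space the coding map is what it should be. -/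
theorem iInter_range_wordMap [MetricSpace X] [CompactSpace X] [Nonempty X] {f : ℕ → X → X}
    {s : ℝ≥0} (hs : s < 1) (hf : ∀ i, LipschitzWith s (f i)) (ω : ℕ → ℕ) :
    ⋂ n : ℕ, range (wordMap f (initialWord ω n)) = {codingMap f ω} := by
  have hlip : ∀ w : List ℕ, LipschitzWith (s ^ w.length) (wordMap f w) := by
    intro w
    induction w with
    | nil => simpa [wordMap] using LipschitzWith.id
    | cons i w ih => simpa [wordMap, pow_succ'] using (hf i).comp ih
  have hne : (⋂ n : ℕ, range (wordMap f (initialWord ω n))).Nonempty := by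
    apply IsCompact.nonempty_iInter_of_sequence_nonempty_isCompact_isClosed
    · intro n
      rw [initialWord_succ, wordMap_append]
      exact range_comp_subset_range _ _
    · intro n
      exact range_nonempty _
    · exact isCompact_range (hlip _).continuous
    · intro n
      exact (isCompact_range (hlip _).continuous).isClosed
  have hmem : codingMap f ω ∈ ⋂ n : ℕ, range (wordMap f (initialWord ω n)) :=
    Classical.epsilon_spec hne
  refine Subset.antisymm (fun y hy => ?_) (singleton_subset_iff.mpr hmem)
  rw [mem_singleton_iff, ← dist_le_zero]
  have hb : ∀ n : ℕ, dist y (codingMap f ω) ≤ (s : ℝ) ^ n * Metric.diam (univ : Set X) := by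
    intro n
    obtain ⟨u, hu⟩ := mem_iInter.mp hy n
    obtain ⟨v, hv⟩ := mem_iInter.mp hmem n
    have h1 := (hlip (initialWord ω n)).dist_le_mul u v
    rw [hu, hv] at h1
    have h2 : dist u v ≤ Metric.diam (univ : Set X) :=
      Metric.dist_le_diam_of_mem isCompact_univ.isBounded (mem_univ u) (mem_univ v)
    have h3 : (initialWord ω n).length = n := by simp [initialWord]
    rw [h3] at h1
    push_cast at h1
    exact h1.trans (by gcongr)
  have hlim : Tendsto (fun n : ℕ => (s : ℝ) ^ n * Metric.diam (univ : Set X)) atTop (𝓝 0) := by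
    simpa using (tendsto_pow_atTop_nhds_zero_of_lt_one s.2
      (by exact_mod_cast hs)).mul_const (Metric.diam (univ : Set X))
  exact ge_of_tendsto' hlim hb

variable [TopologicalSpace X]

/-- The potential `φ(ω) = φ^{(ω_1)}(π(σ ω))` on the shift space; `p i` is `φ^{(i)}`. -/
noncomputable def potential [Nonempty X] (f : ℕ → X → X) (p : ℕ → C(X, ℝ)) (ω : ℕ → ℕ) : ℝ :=
  p (ω 0) (codingMap f (shift ω))

/-- `S_w(φ) = ∑_{j=1}^{n} φ^{(w_j)} ∘ f_{w_{j+1} ⋯ w_n}` for a word `w` of length `n`. -/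
noncomputable def wordSum (f : ℕ → X → X) (p : ℕ → C(X, ℝ)) : List ℕ → X → ℝ
  | [] => fun _ => 0
  | i :: w => fun x => p i (wordMap f w x) + wordSum f p w x

/-- The auxiliary Perron-Frobenius operator `g ↦ ∑ i, exp (φ^{(i)}) g ∘ f_i` on functions on `X`. -/
noncomputable def transfer (f : ℕ → X → X) (p : ℕ → C(X, ℝ)) (g : C(X, ℝ)) (x : X) : ℝ :=
  ∑' i : ℕ, Real.exp (p i x) * g (f i x)

/-- `m` is a fixed point `m_φ` of `m ↦ L^* m / (L^* m)(1)`, where `L` is the operator `transfer` and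
`L^* m` is the functional `g ↦ ∫ L g dm` on `C(X)`. -/
def IsEigenmeasure [MeasurableSpace X] (f : ℕ → X → X) (p : ℕ → C(X, ℝ)) (m : Measure X) : Prop :=
  IsProbabilityMeasure m ∧
    ∀ g : C(X, ℝ), ∫ x, transfer f p g x ∂m = (∫ x, transfer f p 1 x ∂m) * ∫ x, g x ∂m

/-- `ν` is the lift of `m` to the shift space: the Borel probability measure with
`ν [w] = ∫ exp (S_w(φ) - P(φ) |w|) dm` for every finite word `w`. -/
def IsLift [Nonempty X] [MeasurableSpace X] (f : ℕ → X → X) (p : ℕ → C(X, ℝ)) (m : Measure X)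
    (ν : Measure (ℕ → ℕ)) : Prop :=
  IsProbabilityMeasure ν ∧ ∀ w : List ℕ, ν.real (wordCylinder w) =
    ∫ x, Real.exp (wordSum f p w x - pressure (potential f p) * w.length) ∂m

/-- `μ` is the invariant measure attached to the system: a probability measure on the shift space
that is invariant and ergodic under all iterates of the shift, and absolutely continuous with respect
to the lift of an eigenmeasure. (`Ergodic` includes invariance.) -/
def IsInvariantGibbs [Nonempty X] [MeasurableSpace X] (f : ℕ → X → X) (p : ℕ → C(X, ℝ))
    (μ : Measure (ℕ → ℕ)) : Prop :=
  IsProbabilityMeasure μ ∧ (∀ n : ℕ, 1 ≤ n → Ergodic shift^[n] μ) ∧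
    ∃ (m : Measure X) (ν : Measure (ℕ → ℕ)), IsEigenmeasure f p m ∧ IsLift f p m ν ∧ μ ≪ ν

end IFS

end CountableShift

namespace CountableShift

set_option linter.unusedSectionVars false

/-! ### Words and cylinders -/

/-! Everything rests on one distortion estimate. Let `K` be the closure of the set of coding points.
By the Hölder condition the sums `S_w` oscillate on `K` by at most a constant `D` that does not
depend on `w` (`exists_hasBoundedDistortion`). Hence the logarithm of `∑_{|w|=n} exp S_w(x)`, `x ∈
K`, is additive in `n` up to `D`, so it stays within `D` of `nP` (`exists_abs_sub_mul_le`). This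
gives the limit and its finiteness, and it is sharp enough to produce an eigenmeasure with
eigenvalue `e^P` as a limit of weighted averages of `(L^*)^n δ_x`
(`exists_eigenmeasure_of_positive`).

Every eigenmeasure is carried by `K`, because the maps contract towards `K`
(`IsEigenmeasure.ae_mem`). So a lift `ν` satisfies `ν[vw] ≍ ν[v] ν[w]` (`IsLift.isQuasiBernoulli`).
Such a measure is trivial on sets invariant under any iterate of the shift, and its Cesàro averages
under the shift remain comparable with `ν`; a limit of them is an invariant measure comparable with
`ν` and ergodic for all iterates (`IsQuasiBernoulli.exists_ergodic`). By ergodicity it is the only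
invariant probability measure absolutely continuous with respect to `ν`, hence it is the given `μ`.

Consequently `-log μ[ω|n] = nP - S_n φ(ω) + O(1)` (`IsLift.isGibbs`). The summability hypothesis
says that `φ` is integrable, since `ν[i] ≍ exp(φ|[i])` (`IsLift.integrable_potential`). Integrating,
the countable partition into cylinders of length `n` has entropy `n(P - ∫ φ dμ) + O(1)`. As the
entropy of `shift` is defined by finite partitions, it remains to compare these with the partition
by the first letter: its truncations lose arbitrarily little entropy, and every finite partition is
nearly determined by finitely many truncated letters (`IsGibbs.ksEntropy_eq`). -/

theorem initialWord_length (ω : ℕ → ℕ) (n : ℕ) : (initialWord ω n).length = n := by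
  simp [initialWord]

theorem getElem_initialWord (ω : ℕ → ℕ) (n k : ℕ) (hk : k < (initialWord ω n).length) :
    (initialWord ω n)[k] = ω k := by
  simp [initialWord]

theorem mem_wordCylinder_iff {w : List ℕ} {ω : ℕ → ℕ} :
    ω ∈ wordCylinder w ↔ initialWord ω w.length = w := by
  constructor
  · intro h
    refine List.ext_getElem (initialWord_length _ _) fun k h₁ h₂ => ?_
    rw [getElem_initialWord]
    exact h k h₂
  · intro h k hk
    have h₁ : k < (initialWord ω w.length).length := by rwa [initialWord_length]
    rw [← getElem_initialWord ω w.length k h₁]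
    simp only [h]

theorem mem_wordCylinder_initialWord (ω : ℕ → ℕ) (n : ℕ) :
    ω ∈ wordCylinder (initialWord ω n) := by
  rw [mem_wordCylinder_iff, initialWord_length]

theorem shift_iterate_apply (n : ℕ) (ω : ℕ → ℕ) (k : ℕ) : shift^[n] ω k = ω (k + n) := by
  induction n generalizing ω with
  | zero => rfl
  | succ n ih => rw [Function.iterate_succ_apply, ih, shift]; congr 1

theorem initialWord_succ_eq_cons (ω : ℕ → ℕ) (n : ℕ) :
    initialWord ω (n + 1) = ω 0 :: initialWord (shift ω) n := by
  simp only [initialWord, List.range_succ_eq_map, List.map_cons, List.map_map]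
  rfl

theorem initialWord_add (ω : ℕ → ℕ) (m n : ℕ) :
    initialWord ω (m + n) = initialWord ω m ++ initialWord (shift^[m] ω) n := by
  induction m generalizing ω with
  | zero => simp [initialWord]
  | succ m ih =>
    rw [add_right_comm, initialWord_succ_eq_cons, ih, initialWord_succ_eq_cons,
      Function.iterate_succ_apply, List.cons_append]

theorem wordCylinder_nil : wordCylinder [] = univ := by
  ext ω; simp [wordCylinder]

theorem wordCylinder_append (v w : List ℕ) :
    wordCylinder (v ++ w) = wordCylinder v ∩ shift^[v.length] ⁻¹' wordCylinder w := by
  ext ω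
  rw [mem_inter_iff, mem_preimage, mem_wordCylinder_iff, mem_wordCylinder_iff,
    mem_wordCylinder_iff, List.length_append, initialWord_add]
  constructor
  · intro h
    exact List.append_inj h (initialWord_length _ _)
  · rintro ⟨h₁, h₂⟩
    rw [h₁, h₂]

theorem measurable_shift : Measurable shift :=
  measurable_pi_lambda _ fun k => measurable_pi_apply (k + 1)

theorem measurableSet_wordCylinder (w : List ℕ) : MeasurableSet (wordCylinder w) := by
  have : wordCylinder w = ⋂ (k : ℕ) (hk : k < w.length), (fun ω : ℕ → ℕ => ω k) ⁻¹' {w[k]} := by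
    ext ω; simp [wordCylinder]
  rw [this]
  exact MeasurableSet.iInter fun k => MeasurableSet.iInter fun hk =>
    measurable_pi_apply k (measurableSet_singleton _)

theorem disjoint_wordCylinder {v w : List ℕ} (hl : v.length = w.length) (h : v ≠ w) :
    Disjoint (wordCylinder v) (wordCylinder w) := by
  rw [Set.disjoint_left]
  intro ω hv hw
  rw [mem_wordCylinder_iff] at hv hw
  exact h (by rw [← hv, ← hw, hl])

theorem wordCylinder_subset_of_prefix {v w : List ℕ} (h : v <+: w) :
    wordCylinder w ⊆ wordCylinder v := by
  obtain ⟨u, rfl⟩ := h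
  rw [wordCylinder_append]
  exact inter_subset_left

theorem iUnion_wordCylinder (n : ℕ) :
    ⋃ w : {w : List ℕ // w.length = n}, wordCylinder w.1 = univ :=
  eq_univ_of_forall fun ω => mem_iUnion.2
    ⟨⟨initialWord ω n, initialWord_length ω n⟩, mem_wordCylinder_initialWord ω n⟩

theorem pairwise_disjoint_wordCylinder (n : ℕ) :
    Pairwise (Function.onFun Disjoint fun w : {w : List ℕ // w.length = n} => wordCylinder w.1) :=
  fun v w h => disjoint_wordCylinder (v.2.trans w.2.symm) fun h' => h (Subtype.ext h')

/-- A set has the sum of the measures of its pieces in the cylinders of a given length. -/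
theorem measure_eq_tsum_inter_wordCylinder (μ : Measure (ℕ → ℕ)) (n : ℕ) {A : Set (ℕ → ℕ)}
    (hA : MeasurableSet A) :
    μ A = ∑' w : {w : List ℕ // w.length = n}, μ (wordCylinder w.1 ∩ A) := by
  rw [← measure_iUnion (f := fun w : {w : List ℕ // w.length = n} => wordCylinder w.1 ∩ A) _
    fun w => (measurableSet_wordCylinder w.1).inter hA, ← iUnion_inter,
    iUnion_wordCylinder, univ_inter]
  intro v w h
  exact (pairwise_disjoint_wordCylinder n h).mono inter_subset_left inter_subset_left

theorem wordCylinder_singleton_eq (i : ℕ) : wordCylinder [i] = {ω | ω 0 = i} := by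
  ext ω; simp [wordCylinder]

theorem measure_wordCylinder_eq_tsum_append (μ : Measure (ℕ → ℕ)) (w : List ℕ) :
    μ (wordCylinder w) = ∑' i : ℕ, μ (wordCylinder (w ++ [i])) := by
  rw [← measure_iUnion (f := fun i => wordCylinder (w ++ [i])) _
    fun i => measurableSet_wordCylinder (w ++ [i])]
  · congr 1
    ext ω
    simp [wordCylinder_append, wordCylinder_singleton_eq]
  · intro i j h
    exact disjoint_wordCylinder (by simp) (by simpa using h)

/-- Two cylinders that meet are nested, the shorter word being a prefix of the longer one. -/
theorem isPiSystem_wordCylinder : IsPiSystem (range wordCylinder) := by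
  have key : ∀ v w : List ℕ, v.length ≤ w.length → (wordCylinder v ∩ wordCylinder w).Nonempty →
      wordCylinder v ∩ wordCylinder w ∈ range wordCylinder := by
    rintro v w hl ⟨ω, hv, hw⟩
    rw [mem_wordCylinder_iff] at hv hw
    obtain ⟨k, hk⟩ := Nat.exists_eq_add_of_le hl
    refine ⟨w, (inter_eq_right.2 (wordCylinder_subset_of_prefix ?_)).symm⟩
    rw [hk, initialWord_add, hv] at hw
    exact ⟨_, hw⟩
  rintro _ ⟨v, rfl⟩ _ ⟨w, rfl⟩ h
  rcases le_total v.length w.length with hl | hl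
  · exact key v w hl h
  · rw [inter_comm] at h ⊢
    exact key w v hl h

theorem generateFrom_wordCylinder :
    MeasurableSpace.generateFrom (range wordCylinder) = MeasurableSpace.pi := by
  apply le_antisymm
  · apply MeasurableSpace.generateFrom_le
    rintro _ ⟨w, rfl⟩
    exact measurableSet_wordCylinder w
  · refine iSup_le fun k => ?_
    rintro _ ⟨s, -, rfl⟩
    have : (fun ω : ℕ → ℕ => ω k) ⁻¹' s =
        ⋃ (w : List ℕ) (_ : ∃ h : k < w.length, w[k] ∈ s), wordCylinder w := by
      ext ω
      simp only [mem_preimage, mem_iUnion, exists_prop]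
      constructor
      · intro h
        refine ⟨initialWord ω (k + 1), ⟨?_, ?_⟩, mem_wordCylinder_initialWord ω (k + 1)⟩
        · rw [initialWord_length]; exact Nat.lt_succ_self k
        · rwa [getElem_initialWord]
      · rintro ⟨w, ⟨hk, h⟩, hω⟩
        rwa [hω k hk]
    rw [this]
    refine MeasurableSet.iUnion fun w => MeasurableSet.iUnion fun _ =>
      MeasurableSpace.measurableSet_generateFrom (mem_range_self w)

theorem ext_of_wordCylinder {μ ν : Measure (ℕ → ℕ)} [IsFiniteMeasure μ]
    (h : ∀ w, μ (wordCylinder w) = ν (wordCylinder w)) : μ = ν := by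
  refine ext_of_generate_finite _ generateFrom_wordCylinder.symm isPiSystem_wordCylinder ?_ ?_
  · rintro _ ⟨w, rfl⟩
    exact h w
  · rw [← wordCylinder_nil]
    exact h []

/-- Words of length `n + 1` are a letter followed by a word of length `n`. -/
def consEquiv (n : ℕ) :
    ℕ × {w : List ℕ // w.length = n} ≃ {w : List ℕ // w.length = n + 1} where
  toFun x := ⟨x.1 :: x.2.1, by simp [x.2.2]⟩
  invFun w := ⟨w.1.head (List.ne_nil_of_length_eq_add_one w.2), w.1.tail, by simp [w.2]⟩
  left_inv x := by simp
  right_inv w := by simp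

theorem tsum_word_succ (n : ℕ) (F : List ℕ → ℝ≥0∞) :
    ∑' w : {w : List ℕ // w.length = n + 1}, F w.1 =
      ∑' w : {w : List ℕ // w.length = n}, ∑' i : ℕ, F (i :: w.1) := by
  rw [← (consEquiv n).tsum_eq, ENNReal.tsum_prod', ENNReal.tsum_comm]
  rfl

theorem tsum_word_zero (F : List ℕ → ℝ≥0∞) :
    ∑' w : {w : List ℕ // w.length = 0}, F w.1 = F [] := by
  have : Unique {w : List ℕ // w.length = 0} :=
    ⟨⟨⟨[], rfl⟩⟩, fun w => Subtype.ext (List.length_eq_zero_iff.1 w.2)⟩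
  rw [tsum_eq_single (⟨[], rfl⟩ : {w : List ℕ // w.length = 0})]
  intro w hw
  exact absurd (Subtype.ext (List.length_eq_zero_iff.1 w.2)) hw

/-! ### Measures with prescribed values on cylinders -/

section Extension

open ProbabilityTheory Preorder

/-- The distribution of the letter that follows the word `w`, for the weights `q`. -/
noncomputable def nextLetter (q : List ℕ → ℝ≥0∞) (w : List ℕ) : Measure ℕ :=
  if q w = 0 ∨ q w = ⊤ then Measure.dirac 0
  else Measure.sum fun i => (q (w ++ [i]) / q w) • Measure.dirac i

theorem nextLetter_singleton {q : List ℕ → ℝ≥0∞} {w : List ℕ} (h : q w ≠ 0) (h' : q w ≠ ⊤)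
    (i : ℕ) : nextLetter q w {i} = q (w ++ [i]) / q w := by
  rw [nextLetter, if_neg (by tauto), Measure.sum_apply _ (measurableSet_singleton i),
    tsum_eq_single i]
  · simp
  · intro j hj
    simp [hj]

theorem isProbabilityMeasure_nextLetter {q : List ℕ → ℝ≥0∞}
    (hq : ∀ w, q w = ∑' i, q (w ++ [i])) (w : List ℕ) :
    IsProbabilityMeasure (nextLetter q w) := by
  by_cases h : q w = 0 ∨ q w = ⊤
  · rw [nextLetter, if_pos h]
    infer_instance
  · constructor
    rw [nextLetter, if_neg h, Measure.sum_apply _ MeasurableSet.univ]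
    push Not at h
    simp only [Measure.smul_apply, measure_univ, smul_eq_mul, mul_one, div_eq_mul_inv]
    rw [ENNReal.tsum_mul_right, ← hq w, ENNReal.mul_inv_cancel h.1 h.2]

/-- The letters `x 1, …, x n` as a word. -/
def tailWord {n : ℕ} (x : (i : Finset.Iic n) → ℕ) : List ℕ :=
  List.ofFn fun k : Fin n => x ⟨k + 1, Finset.mem_Iic.2 k.2⟩

/-- The transition kernels of the process that chooses letters according to the weights `q`. -/
noncomputable def letterKernel (q : List ℕ → ℝ≥0∞) (n : ℕ) : Kernel ((i : Finset.Iic n) → ℕ) ℕ :=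
  Kernel.ofFunOfCountable fun x => nextLetter q (tailWord x)

/-- The conditional probabilities `q (v ++ [i]) / q v` telescope along a word. Coordinate `0` of a
trajectory is only a starting point, which `tailWord` leaves out. -/
theorem partialTraj_letterKernel {q : List ℕ → ℝ≥0∞} (hq1 : q [] = 1)
    (hq : ∀ w, q w = ∑' i, q (w ++ [i])) (hfin : ∀ w, q w ≠ ⊤) (x₀ : (i : Finset.Iic 0) → ℕ) (n : ℕ)
    (w : List ℕ) (hw : w.length = n) :
    Kernel.partialTraj (X := fun _ => ℕ) (letterKernel q) 0 n x₀ {x | tailWord x = w} = q w := by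
  have hM (n : ℕ) : IsMarkovKernel (letterKernel q n) :=
    ⟨fun x => isProbabilityMeasure_nextLetter hq _⟩
  induction n generalizing w with
  | zero =>
    obtain rfl := List.length_eq_zero_iff.1 hw
    rw [hq1]
    have : {x : (i : Finset.Iic 0) → ℕ | tailWord x = []} = univ := by
      ext x; simp [tailWord]
    rw [this, measure_univ]
  | succ n ih =>
    obtain ⟨v, i, rfl⟩ : ∃ v i, w = v ++ [i] :=
      ⟨w.dropLast, w.getLast (List.ne_nil_of_length_eq_add_one hw),
        (List.dropLast_append_getLast _).symm⟩
    have hv : v.length = n := by simpa using hw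
    rw [Kernel.partialTraj_succ_of_le (Nat.zero_le n), Kernel.map_apply' _
      (measurable_IicProdIoc (X := fun _ => ℕ) (m := n) (n := n + 1)) _
      (Set.to_countable _).measurableSet, Kernel.comp_apply' _ _ _
      (measurable_IicProdIoc (X := fun _ => ℕ) (m := n) (n := n + 1) (Set.to_countable _).measurableSet)]
    have key : ∀ x : (i : Finset.Iic n) → ℕ,
        (Kernel.id ×ₖ (letterKernel q n).map (MeasurableEquiv.piSingleton (X := fun _ => ℕ) n)) x
          (IicProdIoc (X := fun _ => ℕ) n (n + 1) ⁻¹' {x | tailWord x = v ++ [i]}) =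
        {x | tailWord x = v}.indicator (fun _ => nextLetter q v {i}) x := by
      intro x
      have hpre : IicProdIoc (X := fun _ => ℕ) n (n + 1) ⁻¹' {x | tailWord x = v ++ [i]} =
          {x | tailWord x = v} ×ˢ {y | y ⟨n + 1, by simp⟩ = i} := by
        ext ⟨x, y⟩
        have h₁ : tailWord (IicProdIoc (X := fun _ => ℕ) n (n + 1) (x, y)) =
            tailWord x ++ [y ⟨n + 1, by simp⟩] := by
          rw [tailWord, List.ofFn_succ', List.concat_eq_append]
          simp only [Fin.val_last, Fin.val_castSucc, tailWord, IicProdIoc]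
          congr 1
          · congr 1
            ext k
            rw [dif_pos (by have := k.2; omega)]
          · rw [dif_neg (by omega)]
        rw [mem_preimage, mem_ofPred_eq, h₁]
        simp
      rw [hpre, Kernel.prod_apply, Measure.prod_prod, Kernel.id_apply, Kernel.map_apply' _
        (MeasurableEquiv.measurable _) _ (Set.to_countable _).measurableSet,
        Measure.dirac_apply' _ (Set.to_countable _).measurableSet]
      have hs : MeasurableEquiv.piSingleton (X := fun _ => ℕ) n ⁻¹' {y | y ⟨n + 1, by simp⟩ = i} =
          {i} := by
        ext j
        simp [MeasurableEquiv.piSingleton]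
      rw [hs]
      by_cases hx : tailWord x = v
      · have : letterKernel q n x = nextLetter q v := by rw [← hx]; rfl
        simp [hx, this]
      · simp [hx]
    simp_rw [key]
    rw [lintegral_indicator (Set.to_countable _).measurableSet, setLIntegral_const, ih v hv]
    -- After a word of weight zero the default law of the next letter is harmless: consistency
    -- forces `q (v ++ [i]) = 0`.
    by_cases h0 : q v = 0
    · rw [h0, mul_zero]
      have := hq v
      rw [h0, eq_comm, ENNReal.tsum_eq_zero] at this
      exact (this i).symm
    · rw [nextLetter_singleton h0 (hfin v), ENNReal.div_mul_cancel h0 (hfin v)]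

/-- Consistent weights on the words are the measures of the cylinders for a probability measure. -/
theorem exists_measure_wordCylinder_eq {q : List ℕ → ℝ≥0∞} (hq1 : q [] = 1)
    (hq : ∀ w, q w = ∑' i, q (w ++ [i])) :
    ∃ μ : Measure (ℕ → ℕ), IsProbabilityMeasure μ ∧ ∀ w, μ (wordCylinder w) = q w := by
  have hfin : ∀ w, q w ≠ ⊤ := by
    intro w
    induction w using List.reverseRecOn with
    | nil => simp [hq1]
    | append_singleton w i ih =>
      rw [hq w] at ih
      exact ENNReal.ne_top_of_tsum_ne_top ih i
  have hM (n : ℕ) : IsMarkovKernel (letterKernel q n) :=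
    ⟨fun x => isProbabilityMeasure_nextLetter hq _⟩
  refine ⟨(Kernel.traj (X := fun _ => ℕ) (letterKernel q) 0 fun _ => 0).map shift,
    Measure.isProbabilityMeasure_map measurable_shift.aemeasurable, fun w => ?_⟩
  rw [Measure.map_apply measurable_shift (measurableSet_wordCylinder w),
    ← partialTraj_letterKernel hq1 hq hfin (fun _ => 0) w.length w rfl,
    ← Kernel.traj_map_frestrictLe_apply, Measure.map_apply (measurable_frestrictLe _)
    (Set.to_countable _).measurableSet]
  congr 1
  ext ω
  rw [mem_preimage, mem_wordCylinder_iff, mem_preimage, mem_ofPred_eq]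
  have : tailWord (frestrictLe (π := fun _ => ℕ) w.length ω) = initialWord (shift ω) w.length := by
    refine List.ext_getElem (by simp [tailWord, initialWord]) fun k h₁ h₂ => ?_
    simp [tailWord, initialWord, shift]
  rw [this]

end Extension

theorem exists_finite_measure_wordCylinder_eq {q : List ℕ → ℝ≥0∞} (hq1 : q [] ≠ ⊤)
    (hq : ∀ w, q w = ∑' i, q (w ++ [i])) :
    ∃ μ : Measure (ℕ → ℕ), IsFiniteMeasure μ ∧ ∀ w, μ (wordCylinder w) = q w := by
  by_cases h0 : q [] = 0
  · refine ⟨0, inferInstance, fun w => ?_⟩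
    induction w using List.reverseRecOn with
    | nil => simp [h0]
    | append_singleton w i ih =>
      have h := hq w
      rw [← ih, Measure.coe_zero, Pi.zero_apply, eq_comm, ENNReal.tsum_eq_zero] at h
      rw [h i, Measure.coe_zero, Pi.zero_apply]
  · obtain ⟨μ, hμ, h⟩ := exists_measure_wordCylinder_eq (q := fun w => (q [])⁻¹ * q w)
      (ENNReal.inv_mul_cancel h0 hq1) fun w => by rw [ENNReal.tsum_mul_left, ← hq w]
    refine ⟨q [] • μ, ⟨?_⟩, fun w => ?_⟩
    · simpa using hq1.lt_top
    · rw [Measure.smul_apply, h, smul_eq_mul, ← mul_assoc, ENNReal.mul_inv_cancel h0 hq1, one_mul]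

/-- Finite measures can be compared on the cylinders. -/
theorem measure_le_of_wordCylinder {μ ν : Measure (ℕ → ℕ)} [IsFiniteMeasure μ] [IsFiniteMeasure ν]
    (h : ∀ w, μ (wordCylinder w) ≤ ν (wordCylinder w)) : μ ≤ ν := by
  -- The differences of the cylinder masses are again consistent weights, so they belong to a
  -- measure `ρ`, and `ν = μ + ρ`.
  obtain ⟨ρ, hρ, h'⟩ := exists_finite_measure_wordCylinder_eq
    (q := fun w => ν (wordCylinder w) - μ (wordCylinder w))
    (ne_top_of_le_ne_top (measure_ne_top ν _) tsub_le_self) fun w => by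
      rw [ENNReal.tsum_sub _ fun i => h (w ++ [i]), ← measure_wordCylinder_eq_tsum_append,
        ← measure_wordCylinder_eq_tsum_append]
      rw [← measure_wordCylinder_eq_tsum_append]
      exact measure_ne_top μ _
  have : ν = μ + ρ := ext_of_wordCylinder fun w => by
    rw [Measure.add_apply, h', add_tsub_cancel_of_le (h w)]
  rw [this]
  exact Measure.le_add_right le_rfl

/-! ### Quasi-Bernoulli measures -/

/-- A probability measure on the shift space for which the letters are independent up to a
bounded factor. -/
structure IsQuasiBernoulli (C : ℝ≥0) (ν : Measure (ℕ → ℕ)) : Prop where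
  isProbabilityMeasure : IsProbabilityMeasure ν
  le_mul : ∀ v w, ν (wordCylinder (v ++ w)) ≤ C * (ν (wordCylinder v) * ν (wordCylinder w))
  mul_le : ∀ v w, ν (wordCylinder v) * ν (wordCylinder w) ≤ C * ν (wordCylinder (v ++ w))

namespace IsQuasiBernoulli

variable {C : ℝ≥0} {ν : Measure (ℕ → ℕ)}

/-- For fixed `v` both sides are finite measures of `B`, so it is enough to compare them on
cylinders, where the bound is `le_mul`. -/
theorem measure_inter_le (h : IsQuasiBernoulli C ν) (v : List ℕ) {B : Set (ℕ → ℕ)}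
    (hB : MeasurableSet B) :
    ν (wordCylinder v ∩ shift^[v.length] ⁻¹' B) ≤ C * (ν (wordCylinder v) * ν B) := by
  have := h.isProbabilityMeasure
  have hm := measurable_shift.iterate v.length
  have : (ν.restrict (wordCylinder v)).map shift^[v.length] ≤
      (C * (ν.real (wordCylinder v)).toNNReal) • ν := by
    refine measure_le_of_wordCylinder fun w => ?_
    rw [Measure.map_apply hm (measurableSet_wordCylinder w),
      Measure.restrict_apply (hm (measurableSet_wordCylinder w)), inter_comm,
      ← wordCylinder_append, Measure.smul_apply, ENNReal.smul_def, smul_eq_mul]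
    simpa [mul_assoc, measureReal_def] using h.le_mul v w
  have := this B
  rw [Measure.map_apply hm hB, Measure.restrict_apply (hm hB), inter_comm, Measure.smul_apply,
    ENNReal.smul_def, smul_eq_mul] at this
  simpa [mul_assoc, measureReal_def] using this

theorem mul_le_measure_inter (h : IsQuasiBernoulli C ν) (v : List ℕ) {B : Set (ℕ → ℕ)}
    (hB : MeasurableSet B) :
    ν (wordCylinder v) * ν B ≤ C * ν (wordCylinder v ∩ shift^[v.length] ⁻¹' B) := by
  have := h.isProbabilityMeasure
  have hm := measurable_shift.iterate v.length
  have : (ν.real (wordCylinder v)).toNNReal • ν ≤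
      C • (ν.restrict (wordCylinder v)).map shift^[v.length] := by
    refine measure_le_of_wordCylinder fun w => ?_
    rw [Measure.smul_apply, Measure.smul_apply, Measure.map_apply hm (measurableSet_wordCylinder w),
      Measure.restrict_apply (hm (measurableSet_wordCylinder w)), inter_comm,
      ← wordCylinder_append, ENNReal.smul_def, smul_eq_mul, ENNReal.smul_def, smul_eq_mul]
    simpa [measureReal_def] using h.mul_le v w
  have := this B
  rw [Measure.smul_apply, Measure.smul_apply, Measure.map_apply hm hB,
    Measure.restrict_apply (hm hB), inter_comm, ENNReal.smul_def, smul_eq_mul, ENNReal.smul_def,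
    smul_eq_mul] at this
  simpa [measureReal_def] using this

theorem tsum_measure_word (h : IsQuasiBernoulli C ν) (n : ℕ) :
    ∑' w : {w : List ℕ // w.length = n}, ν (wordCylinder w.1) = 1 := by
  have := h.isProbabilityMeasure
  have := measure_eq_tsum_inter_wordCylinder ν n MeasurableSet.univ
  simpa using this.symm

/-- Sum the estimate for a single word over all words of length `n`. That the constant does not
depend on `n` is what keeps the Cesàro averages under control. -/
theorem measure_preimage_le (h : IsQuasiBernoulli C ν) (n : ℕ) {B : Set (ℕ → ℕ)}
    (hB : MeasurableSet B) : ν (shift^[n] ⁻¹' B) ≤ C * ν B := by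
  rw [measure_eq_tsum_inter_wordCylinder ν n (measurable_shift.iterate n hB)]
  calc ∑' w : {w : List ℕ // w.length = n}, ν (wordCylinder w.1 ∩ shift^[n] ⁻¹' B)
      ≤ ∑' w : {w : List ℕ // w.length = n}, ν (wordCylinder w.1) * (C * ν B) := by
        refine ENNReal.tsum_le_tsum fun w => ?_
        have := h.measure_inter_le w.1 hB
        rw [w.2] at this
        refine this.trans_eq (by ring)
    _ = C * ν B := by rw [ENNReal.tsum_mul_right, h.tsum_measure_word, one_mul]

theorem le_measure_preimage (h : IsQuasiBernoulli C ν) (n : ℕ) {B : Set (ℕ → ℕ)}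
    (hB : MeasurableSet B) : ν B ≤ C * ν (shift^[n] ⁻¹' B) := by
  rw [measure_eq_tsum_inter_wordCylinder ν n (measurable_shift.iterate n hB),
    ← ENNReal.tsum_mul_left]
  calc ν B = ∑' w : {w : List ℕ // w.length = n}, ν (wordCylinder w.1) * ν B := by
        rw [ENNReal.tsum_mul_right, h.tsum_measure_word, one_mul]
    _ ≤ ∑' w : {w : List ℕ // w.length = n}, C * ν (wordCylinder w.1 ∩ shift^[n] ⁻¹' B) := by
        refine ENNReal.tsum_le_tsum fun w => ?_
        have := h.mul_le_measure_inter w.1 hB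
        rwa [w.2] at this

/-- An invariant `A` is almost independent of every cylinder: `ν(A) ν[w] ≤ C² ν([w] ∩ A)`. This
extends from cylinders to all measurable sets, and for the complement of `A` it reads `ν(A) ν(Aᶜ) =
0`. -/
theorem preErgodic (h : IsQuasiBernoulli C ν) {n : ℕ} (hn : 1 ≤ n) : PreErgodic shift^[n] ν := by
  have := h.isProbabilityMeasure
  refine ⟨fun A hA hinv => ?_⟩
  have hle : (ν.real A).toNNReal • ν ≤ (C * C) • ν.restrict A := by
    refine measure_le_of_wordCylinder fun w => ?_
    -- `A` is invariant only under multiples of `n`, so `j` pads the length of `w` to such a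
    -- multiple; replacing `A` by its `j`-th preimage costs the second factor `C`.
    obtain ⟨j, hj⟩ : ∃ j, n * w.length = j + w.length :=
      ⟨n * w.length - w.length, (Nat.sub_add_cancel (Nat.le_mul_of_pos_left _ hn)).symm⟩
    have hA' : shift^[w.length] ⁻¹' (shift^[j] ⁻¹' A) = A := by
      rw [← preimage_comp, ← Function.iterate_add, ← hj, Function.iterate_mul]
      exact Set.preimage_iterate_eq ▸ Function.iterate_fixed hinv _
    have h₁ := h.mul_le_measure_inter w (measurable_shift.iterate j hA)
    rw [hA'] at h₁
    have h₂ := h.le_measure_preimage j hA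
    rw [Measure.smul_apply, Measure.smul_apply, Measure.restrict_apply
      (measurableSet_wordCylinder w), ENNReal.smul_def, smul_eq_mul, ENNReal.smul_def, smul_eq_mul]
    calc ((ν.real A).toNNReal : ℝ≥0∞) * ν (wordCylinder w)
        = ν (wordCylinder w) * ν A := by simp [measureReal_def, mul_comm]
      _ ≤ ν (wordCylinder w) * (C * ν (shift^[j] ⁻¹' A)) := by gcongr
      _ = C * (ν (wordCylinder w) * ν (shift^[j] ⁻¹' A)) := by ring
      _ ≤ C * (C * ν (wordCylinder w ∩ A)) := by gcongr
      _ = _ := by push_cast; ring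
  have h₀ := hle Aᶜ
  rw [Measure.smul_apply, Measure.smul_apply, Measure.restrict_apply hA.compl, compl_inter_self,
    measure_empty, smul_zero, ENNReal.smul_def, smul_eq_mul, nonpos_iff_eq_zero, mul_eq_zero] at h₀
  rw [eventuallyConst_set']
  rcases h₀ with h₀ | h₀
  · left
    rw [ae_eq_empty]
    simpa [measureReal_def] using h₀
  · right
    rwa [ae_eq_univ]

end IsQuasiBernoulli

/-! ### Setwise limits of dominated measures -/

/-- A sequence of measures dominated by a finite measure has a limit on all measurable sets along
an ultrafilter. -/
theorem exists_measure_tendsto_ultrafilter {Ω : Type*} [MeasurableSpace Ω] {ρ : Measure Ω}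
    [IsFiniteMeasure ρ] {μ : ℕ → Measure Ω} (hμ : ∀ n, μ n ≤ ρ) (U : Ultrafilter ℕ) :
    ∃ m : Measure Ω, m ≤ ρ ∧
      ∀ A, MeasurableSet A → Tendsto (fun n => (μ n).real A) U (𝓝 (m.real A)) := by
  have hle : ∀ n A, (μ n).real A ≤ ρ.real A := fun n A =>
    ENNReal.toReal_mono (measure_ne_top ρ A) (hμ n A)
  have hfin : ∀ n, IsFiniteMeasure (μ n) := fun n => isFiniteMeasure_of_le ρ (hμ n)
  have hex : ∀ A, ∃ x ∈ Icc 0 (ρ.real A), Tendsto (fun n => (μ n).real A) U (𝓝 x) := by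
    intro A
    refine isCompact_Icc.ultrafilter_le_nhds (U.map fun n => (μ n).real A) ?_
    rw [Ultrafilter.coe_map, le_principal_iff, mem_map]
    exact univ_mem' fun n => ⟨measureReal_nonneg, hle n A⟩
  choose r hr hlim using hex
  have hsum : ∀ A : ℕ → Set Ω, (∀ i, MeasurableSet (A i)) → Pairwise (Function.onFun Disjoint A) →
      HasSum (fun i => r (A i)) (r (⋃ i, A i)) := by
    intro A hA hd
    have hHas : ∀ (κ : Measure Ω) [IsFiniteMeasure κ],
        HasSum (fun i => κ.real (A i)) (κ.real (⋃ i, A i)) := by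
      intro κ _
      have h₁ := measure_iUnion (μ := κ) hd hA
      rw [measureReal_def, h₁]
      simp only [measureReal_def]
      rw [ENNReal.tsum_toReal_eq fun i => measure_ne_top κ _]
      exact (ENNReal.summable_toReal (h₁ ▸ measure_ne_top κ _)).hasSum
    have hs : Summable fun i => r (A i) :=
      (hHas ρ).summable.of_nonneg_of_le (fun i => (hr _).1) fun i => (hr _).2
    -- The masses `ρ (A i)` form a summable majorant, so the limit passes through the countable sum.
    -- This is where domination yields σ-additivity.
    have h₁ : Tendsto (fun n => ∑' i, (μ n).real (A i)) U (𝓝 (∑' i, r (A i))) := by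
      refine tendsto_tsum_of_dominated_convergence (hHas ρ).summable (fun i => hlim _) ?_
      refine Eventually.of_forall fun n i => ?_
      rw [Real.norm_of_nonneg measureReal_nonneg]
      exact hle n _
    have h₂ : (fun n => ∑' i, (μ n).real (A i)) = fun n => (μ n).real (⋃ i, A i) :=
      funext fun n => (hHas (μ n)).tsum_eq
    rw [h₂] at h₁
    rw [tendsto_nhds_unique (hlim _) h₁]
    exact hs.hasSum
  have hempty : r ∅ = 0 := le_antisymm (by simpa using (hr ∅).2) (hr ∅).1
  let m : Measure Ω := Measure.ofMeasurable (fun A _ => ENNReal.ofReal (r A))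
    (by rw [hempty, ENNReal.ofReal_zero]) fun A hA hd => by
      rw [← (hsum A hA hd).tsum_eq,
        ENNReal.ofReal_tsum_of_nonneg (fun i => (hr _).1) (hsum A hA hd).summable]
  have hm : ∀ A, MeasurableSet A → m A = ENNReal.ofReal (r A) := fun A hA =>
    Measure.ofMeasurable_apply A hA
  refine ⟨m, Measure.le_iff.2 fun A hA => ?_, fun A hA => ?_⟩
  · rw [hm A hA]
    exact ENNReal.ofReal_le_of_le_toReal (hr A).2
  · rw [measureReal_def, hm A hA, ENNReal.toReal_ofReal (hr A).1]
    exact hlim A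

/-- A quasi-Bernoulli measure is equivalent, up to a bounded factor, to an invariant measure that is
ergodic for all the iterates of the shift. -/
theorem IsQuasiBernoulli.exists_ergodic {C : ℝ≥0} {ν : Measure (ℕ → ℕ)}
    (h : IsQuasiBernoulli C ν) :
    ∃ μ : Measure (ℕ → ℕ), IsProbabilityMeasure μ ∧ (∀ n : ℕ, 1 ≤ n → Ergodic shift^[n] μ) ∧
      μ ≤ C • ν ∧ ν ≤ C • μ := by
  have := h.isProbabilityMeasure
  -- Cesàro averages of the images of `ν`; they are comparable with `ν` in both directions with the
  -- same constant `C`.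
  let κ : ℕ → Measure (ℕ → ℕ) := fun N =>
    ((N : ℝ≥0) + 1)⁻¹ • ∑ k ∈ Finset.range (N + 1), ν.map shift^[k]
  have hκ : ∀ N A, MeasurableSet A →
      κ N A = ((N : ℝ≥0∞) + 1)⁻¹ * ∑ k ∈ Finset.range (N + 1), ν (shift^[k] ⁻¹' A) := by
    intro N A hA
    simp only [κ, Measure.smul_apply, Measure.coe_finsetSum, Finset.sum_apply, ENNReal.smul_def,
      smul_eq_mul]
    rw [ENNReal.coe_inv (by positivity)]
    push_cast
    congr 1
    exact Finset.sum_congr rfl fun k _ => Measure.map_apply (measurable_shift.iterate k) hA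
  have hone : ∀ N : ℕ, ((N : ℝ≥0∞) + 1)⁻¹ * ((N : ℝ≥0∞) + 1) = 1 := by
    intro N
    exact ENNReal.inv_mul_cancel (by simp) (by finiteness)
  have hκle : ∀ N, κ N ≤ C • ν := by
    intro N
    refine Measure.le_iff.2 fun A hA => ?_
    rw [hκ N A hA, Measure.smul_apply, ENNReal.smul_def, smul_eq_mul]
    calc _ ≤ ((N : ℝ≥0∞) + 1)⁻¹ * ∑ k ∈ Finset.range (N + 1), C * ν A := by
          gcongr with k
          exact h.measure_preimage_le k hA
      _ = C * ν A := by
          rw [Finset.sum_const, Finset.card_range, nsmul_eq_mul, ← mul_assoc]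
          rw [Nat.cast_add, Nat.cast_one, hone N, one_mul]
  have hleκ : ∀ N, ν ≤ C • κ N := by
    intro N
    refine Measure.le_iff.2 fun A hA => ?_
    rw [Measure.smul_apply, ENNReal.smul_def, smul_eq_mul, hκ N A hA]
    calc ν A = ((N : ℝ≥0∞) + 1)⁻¹ * ∑ k ∈ Finset.range (N + 1), ν A := by
          rw [Finset.sum_const, Finset.card_range, nsmul_eq_mul, ← mul_assoc]
          rw [Nat.cast_add, Nat.cast_one, hone N, one_mul]
      _ ≤ ((N : ℝ≥0∞) + 1)⁻¹ *
            ∑ k ∈ Finset.range (N + 1), C * ν (shift^[k] ⁻¹' A) := by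
          gcongr with k
          exact h.le_measure_preimage k hA
      _ = _ := by rw [← Finset.mul_sum]; ring
  obtain ⟨μ, hμ, hlim⟩ := exists_measure_tendsto_ultrafilter hκle (hyperfilter ℕ)
  have hreal : ∀ N A, MeasurableSet A → (κ N).real A =
      ((N : ℝ) + 1)⁻¹ * ∑ k ∈ Finset.range (N + 1), ν.real (shift^[k] ⁻¹' A) := by
    intro N A hA
    rw [measureReal_def, hκ N A hA, ENNReal.toReal_mul, ENNReal.toReal_sum (by finiteness),
      ENNReal.toReal_inv, ENNReal.toReal_add (by finiteness) (by finiteness)]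
    simp [measureReal_def]
  have hfin : IsFiniteMeasure μ := isFiniteMeasure_of_le _ hμ
  have hprob : IsProbabilityMeasure μ := by
    have h₁ := hlim univ MeasurableSet.univ
    have h₂ : (fun N => (κ N).real univ) = fun _ => 1 := by
      funext N
      rw [hreal N univ MeasurableSet.univ]
      simp
      field_simp
    rw [h₂] at h₁
    have h₃ := tendsto_nhds_unique h₁ tendsto_const_nhds
    rw [measureReal_def, ENNReal.toReal_eq_one_iff] at h₃
    exact ⟨h₃⟩
  have hinv : MeasurePreserving shift μ μ := by
    refine ⟨measurable_shift, Measure.ext fun A hA => ?_⟩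
    rw [Measure.map_apply measurable_shift hA, ← measureReal_eq_measureReal_iff]
    -- The difference telescopes to two boundary terms, hence is at most `1 / (N + 1)`.
    have h₁ : Tendsto (fun N => (κ N).real (shift ⁻¹' A) - (κ N).real A) (hyperfilter ℕ : Filter ℕ)
        (𝓝 0) := by
      refine Tendsto.mono_left ?_ Nat.hyperfilter_le_atTop
      refine squeeze_zero_norm (a := fun N : ℕ => ((N : ℝ) + 1)⁻¹) (fun N => ?_) ?_
      · rw [hreal N _ hA, hreal N _ (measurable_shift hA), ← mul_sub, ← Finset.sum_sub_distrib]
        have : ∀ k, ν.real (shift^[k] ⁻¹' (shift ⁻¹' A)) = ν.real (shift^[k + 1] ⁻¹' A) := by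
          intro k
          rw [← preimage_comp, ← Function.iterate_succ']
        simp only [this]
        rw [Finset.sum_range_sub (fun k => ν.real (shift^[k] ⁻¹' A)), norm_mul,
          Real.norm_of_nonneg (by positivity)]
        refine mul_le_of_le_one_right (by positivity) ?_
        rw [Real.norm_eq_abs, abs_le]
        constructor
        · linarith [measureReal_nonneg (μ := ν) (s := shift^[N + 1] ⁻¹' A),
            measureReal_le_one (μ := ν) (s := shift^[0] ⁻¹' A)]
        · linarith [measureReal_nonneg (μ := ν) (s := shift^[0] ⁻¹' A),
            measureReal_le_one (μ := ν) (s := shift^[N + 1] ⁻¹' A)]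
      · exact tendsto_one_div_add_atTop_nhds_zero_nat.congr fun N => by simp
    have h₂ := tendsto_nhds_unique h₁ ((hlim _ (measurable_shift hA)).sub (hlim A hA))
    linarith
  refine ⟨μ, hprob, fun n hn => ?_, hμ, Measure.le_iff.2 fun A hA => ?_⟩
  · refine ⟨hinv.iterate n, ⟨fun A hA hA' => ?_⟩⟩
    have hac : μ ≪ ν := Measure.absolutelyContinuous_of_le_smul (c := C) hμ
    have := (h.preErgodic hn).aeconst_set hA hA'
    exact this.anti hac.ae_le
  · rw [Measure.smul_apply, ENNReal.smul_def, smul_eq_mul]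
    have h₁ : ∀ N, ν.real A ≤ C * (κ N).real A := by
      intro N
      have : IsFiniteMeasure (κ N) := isFiniteMeasure_of_le _ (hκle N)
      have h₂ := hleκ N A
      rw [Measure.smul_apply, ENNReal.smul_def, smul_eq_mul] at h₂
      have := ENNReal.toReal_mono (by finiteness) h₂
      simpa [measureReal_def] using this
    have h₂ := ge_of_tendsto' ((hlim A hA).const_mul (C : ℝ)) h₁
    rw [← ENNReal.toReal_le_toReal (by finiteness) (by finiteness)]
    simpa [measureReal_def] using h₂

/-! ### Entropy of finite partitions -/

section Entropy

variable {Ω : Type*} [MeasurableSpace Ω] {μ : Measure Ω} [IsProbabilityMeasure μ]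
variable {ι κ τ : Type*} [Fintype ι] [MeasurableSpace ι] [MeasurableSingletonClass ι]
  [Fintype κ] [MeasurableSpace κ] [MeasurableSingletonClass κ]
  [Fintype τ] [MeasurableSpace τ] [MeasurableSingletonClass τ]

theorem integral_comp_finite {ξ : Ω → ι} (hξ : Measurable ξ) (g : ι → ℝ) :
    ∫ x, g (ξ x) ∂μ = ∑ a, μ.real (ξ ⁻¹' {a}) * g a := by
  have := Measure.isProbabilityMeasure_map (μ := μ) hξ.aemeasurable
  rw [← integral_map (φ := ξ) (f := g) hξ.aemeasurable
    (measurable_of_finite g).aestronglyMeasurable, integral_fintype .of_finite]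
  simp only [measureReal_def, smul_eq_mul]
  refine Finset.sum_congr rfl fun a _ => ?_
  rw [Measure.map_apply hξ (measurableSet_singleton a)]

theorem integrable_comp_finite {ξ : Ω → ι} (hξ : Measurable ξ) (g : ι → ℝ) :
    Integrable (fun x => g (ξ x)) μ := by
  have := Measure.isProbabilityMeasure_map (μ := μ) hξ.aemeasurable
  exact (Integrable.of_finite (μ := μ.map ξ) (f := g)).comp_measurable hξ

theorem partitionEntropy_eq_integral {ξ : Ω → ι} (hξ : Measurable ξ) :
    partitionEntropy μ ξ = ∫ x, -Real.log (μ.real (ξ ⁻¹' {ξ x})) ∂μ := by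
  rw [integral_comp_finite hξ fun a => -Real.log (μ.real (ξ ⁻¹' {a}))]
  refine Finset.sum_congr rfl fun a _ => ?_
  rw [Real.negMulLog]
  ring

theorem ae_measureReal_fiber_pos (ξ : Ω → ι) :
    ∀ᵐ x ∂μ, 0 < μ.real (ξ ⁻¹' {ξ x}) := by
  have h : ∀ a, ∀ᵐ x ∂μ, ξ x = a → 0 < μ.real (ξ ⁻¹' {a}) := by
    intro a
    by_cases ha : μ (ξ ⁻¹' {a}) = 0
    · filter_upwards [compl_mem_ae_iff.2 ha] with x hx hxa
      exact absurd hxa hx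
    · exact Eventually.of_forall fun x _ => ENNReal.toReal_pos ha (measure_ne_top _ _)
  filter_upwards [eventually_all.2 h] with x hx
  exact hx _ rfl

/-- `F` is left general so that it may be the mass of an atom of a countable partition, to which
`partitionEntropy` does not apply. -/
theorem partitionEntropy_le_integral {ξ : Ω → ι} (hξ : Measurable ξ) {F : Ω → ℝ}
    (hF : ∀ᵐ x ∂μ, 0 < F x) (hle : ∀ x, F x ≤ μ.real (ξ ⁻¹' {ξ x}))
    (hint : Integrable (fun x => -Real.log (F x)) μ) :
    partitionEntropy μ ξ ≤ ∫ x, -Real.log (F x) ∂μ := by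
  rw [partitionEntropy_eq_integral hξ]
  refine integral_mono_ae (integrable_comp_finite hξ fun a => -Real.log (μ.real (ξ ⁻¹' {a}))) hint ?_
  filter_upwards [hF] with x hx
  exact neg_le_neg (Real.log_le_log hx (hle x))

/-- A coarser partition has smaller entropy. -/
theorem partitionEntropy_le_of_factor {ξ : Ω → ι} {η : Ω → κ} (hξ : Measurable ξ)
    (hη : Measurable η) (h : ∀ x y, ξ x = ξ y → η x = η y) :
    partitionEntropy μ η ≤ partitionEntropy μ ξ := by
  rw [partitionEntropy_eq_integral hξ]
  refine partitionEntropy_le_integral hη (ae_measureReal_fiber_pos ξ) (fun x => ?_)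
    (integrable_comp_finite hξ fun a => -Real.log (μ.real (ξ ⁻¹' {a})))
  exact measureReal_mono fun y hy => h y x hy

/-- Apply `log t ≤ t - 1` to `t = Pac Pbc / (P Pc)` and average with the weights `P`; the terms
coming from `t - 1` cancel in the sum. -/
theorem sum_negMulLog_submodular (P : ι → κ → τ → ℝ) (hP : ∀ a b c, 0 ≤ P a b c) :
    ∑ a, ∑ b, ∑ c, Real.negMulLog (P a b c) + ∑ c, Real.negMulLog (∑ a, ∑ b, P a b c) ≤
      ∑ a, ∑ c, Real.negMulLog (∑ b, P a b c) + ∑ b, ∑ c, Real.negMulLog (∑ a, P a b c) := by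
  set Pc : τ → ℝ := fun c => ∑ a, ∑ b, P a b c with hPc
  set Pac : ι → τ → ℝ := fun a c => ∑ b, P a b c with hPac
  set Pbc : κ → τ → ℝ := fun b c => ∑ a, P a b c with hPbc
  have hacc : ∀ c, ∑ a, Pac a c = Pc c := fun c => rfl
  have hbcc : ∀ c, ∑ b, Pbc b c = Pc c := fun c =>
    Finset.sum_comm (f := fun b a => P a b c)
  have hac0 : ∀ a c, 0 ≤ Pac a c := fun a c => Finset.sum_nonneg fun b _ => hP a b c
  have hbc0 : ∀ b c, 0 ≤ Pbc b c := fun b c => Finset.sum_nonneg fun a _ => hP a b c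
  have hle_ac : ∀ a b c, P a b c ≤ Pac a c := fun a b c =>
    Finset.single_le_sum (f := fun b => P a b c) (fun b _ => hP a b c) (Finset.mem_univ b)
  have hle_bc : ∀ a b c, P a b c ≤ Pbc b c := fun a b c =>
    Finset.single_le_sum (f := fun a => P a b c) (fun a _ => hP a b c) (Finset.mem_univ a)
  have hle_c : ∀ a c, Pac a c ≤ Pc c := fun a c =>
    Finset.single_le_sum (f := fun a => Pac a c) (fun a _ => hac0 a c) (Finset.mem_univ a)
  have e1 : ∑ a, ∑ c, Real.negMulLog (Pac a c) =
      ∑ a, ∑ b, ∑ c, -(P a b c * Real.log (Pac a c)) := by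
    refine Finset.sum_congr rfl fun a _ => ?_
    rw [Finset.sum_comm]
    refine Finset.sum_congr rfl fun c _ => ?_
    rw [Finset.sum_neg_distrib, ← Finset.sum_mul, Real.negMulLog, neg_mul]
  have e2 : ∑ b, ∑ c, Real.negMulLog (Pbc b c) =
      ∑ a, ∑ b, ∑ c, -(P a b c * Real.log (Pbc b c)) := by
    rw [Finset.sum_comm (f := fun a b => ∑ c, -(P a b c * Real.log (Pbc b c)))]
    refine Finset.sum_congr rfl fun b _ => ?_
    rw [Finset.sum_comm]
    refine Finset.sum_congr rfl fun c _ => ?_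
    rw [Finset.sum_neg_distrib, ← Finset.sum_mul, Real.negMulLog, neg_mul]
  have e3 : ∑ c, Real.negMulLog (Pc c) = ∑ a, ∑ b, ∑ c, -(P a b c * Real.log (Pc c)) := by
    have : ∀ a, ∑ b, ∑ c, -(P a b c * Real.log (Pc c)) =
        ∑ c, -(Pac a c * Real.log (Pc c)) := by
      intro a
      rw [Finset.sum_comm]
      refine Finset.sum_congr rfl fun c _ => ?_
      rw [Finset.sum_neg_distrib, ← Finset.sum_mul]
    rw [Finset.sum_congr rfl fun a _ => this a, Finset.sum_comm]
    refine Finset.sum_congr rfl fun c _ => ?_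
    rw [Finset.sum_neg_distrib, ← Finset.sum_mul, Real.negMulLog, neg_mul]
  have hterm : ∀ a b c, Real.negMulLog (P a b c) + -(P a b c * Real.log (Pc c)) ≤
      -(P a b c * Real.log (Pac a c)) + -(P a b c * Real.log (Pbc b c)) +
        (Pac a c * Pbc b c / Pc c - P a b c) := by
    intro a b c
    rcases (hP a b c).eq_or_lt with h0 | h0
    · rw [← h0]
      have : 0 ≤ Pac a c * Pbc b c / Pc c :=
        div_nonneg (mul_nonneg (hac0 a c) (hbc0 b c)) ((hac0 a c).trans (hle_c a c))
      simpa using this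
    · have h1 : 0 < Pac a c := h0.trans_le (hle_ac a b c)
      have h2 : 0 < Pbc b c := h0.trans_le (hle_bc a b c)
      have h3 : 0 < Pc c := h1.trans_le (hle_c a c)
      have hlog := Real.log_le_sub_one_of_pos
        (show 0 < Pac a c * Pbc b c / (P a b c * Pc c) by positivity)
      rw [Real.log_div (by positivity) (by positivity), Real.log_mul h1.ne' h2.ne',
        Real.log_mul h0.ne' h3.ne'] at hlog
      have hm := mul_le_mul_of_nonneg_left hlog h0.le
      have he : P a b c * (Pac a c * Pbc b c / (P a b c * Pc c) - 1) =
          Pac a c * Pbc b c / Pc c - P a b c := by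
        field_simp
      rw [he] at hm
      rw [Real.negMulLog]
      linarith
  -- Both parts sum to the total mass. Where `Pc c = 0` the convention `0 / 0 = 0` gives the right
  -- value.
  have hratio : ∑ a, ∑ b, ∑ c, (Pac a c * Pbc b c / Pc c - P a b c) = 0 := by
    have h1 : ∑ a, ∑ b, ∑ c, Pac a c * Pbc b c / Pc c = ∑ c, Pc c := by
      have : ∀ a, ∑ b, ∑ c, Pac a c * Pbc b c / Pc c = ∑ c, Pac a c * Pc c / Pc c := by
        intro a
        rw [Finset.sum_comm]
        refine Finset.sum_congr rfl fun c _ => ?_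
        rw [← Finset.sum_div, ← Finset.mul_sum, hbcc]
      rw [Finset.sum_congr rfl fun a _ => this a, Finset.sum_comm]
      refine Finset.sum_congr rfl fun c _ => ?_
      rw [← Finset.sum_div, ← Finset.sum_mul, hacc, mul_self_div_self]
    have h2 : ∑ a, ∑ b, ∑ c, P a b c = ∑ c, Pc c := by
      have : ∀ a, ∑ b, ∑ c, P a b c = ∑ c, Pac a c := fun a =>
        Finset.sum_comm (f := fun b c => P a b c)
      rw [Finset.sum_congr rfl fun a _ => this a, Finset.sum_comm]
    simp only [Finset.sum_sub_distrib]
    rw [h1, h2, sub_self]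
  have hsum := Finset.sum_le_sum fun a (_ : a ∈ Finset.univ) =>
    Finset.sum_le_sum fun b (_ : b ∈ Finset.univ) =>
      Finset.sum_le_sum fun c (_ : c ∈ Finset.univ) => hterm a b c
  rw [e1, e2, e3]
  simp only [Finset.sum_add_distrib, hratio] at hsum ⊢
  linarith

theorem partitionEntropy_prod {ξ : Ω → ι} {η : Ω → κ} :
    partitionEntropy μ (fun x => (ξ x, η x)) =
      ∑ a, ∑ b, Real.negMulLog (μ.real (ξ ⁻¹' {a} ∩ η ⁻¹' {b})) := by
  rw [partitionEntropy, Fintype.sum_prod_type]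
  refine Finset.sum_congr rfl fun a _ => Finset.sum_congr rfl fun b _ => ?_
  congr 2
  ext x
  simp

theorem sum_measureReal_inter_fiber {η : Ω → κ} (hη : Measurable η) {A : Set Ω} :
    ∑ b, μ.real (A ∩ η ⁻¹' {b}) = μ.real A := by
  have h := sum_measureReal_preimage_singleton (μ := μ.restrict A) Finset.univ (f := η)
    fun b _ => hη (measurableSet_singleton b)
  simp only [Finset.coe_univ, preimage_univ, measureReal_restrict_apply_univ] at h
  rw [← h]
  refine Finset.sum_congr rfl fun b _ => ?_
  rw [measureReal_restrict_apply (hη (measurableSet_singleton b)), inter_comm]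

/-- Strong subadditivity of the entropy. -/
theorem partitionEntropy_submodular {ξ : Ω → ι} {η : Ω → κ} (ζ : Ω → τ) (hξ : Measurable ξ)
    (hη : Measurable η) :
    partitionEntropy μ (fun x => (ξ x, η x, ζ x)) + partitionEntropy μ ζ ≤
      partitionEntropy μ (fun x => (ξ x, ζ x)) + partitionEntropy μ (fun x => (η x, ζ x)) := by
  have h := sum_negMulLog_submodular
    (fun a b c => μ.real (ξ ⁻¹' {a} ∩ (η ⁻¹' {b} ∩ ζ ⁻¹' {c}))) fun _ _ _ => measureReal_nonneg
  have hb : ∀ a c, ∑ b, μ.real (ξ ⁻¹' {a} ∩ (η ⁻¹' {b} ∩ ζ ⁻¹' {c})) =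
      μ.real (ξ ⁻¹' {a} ∩ ζ ⁻¹' {c}) := by
    intro a c
    rw [← sum_measureReal_inter_fiber hη]
    refine Finset.sum_congr rfl fun b _ => ?_
    rw [inter_assoc, inter_comm (η ⁻¹' {b})]
  have ha : ∀ b c, ∑ a, μ.real (ξ ⁻¹' {a} ∩ (η ⁻¹' {b} ∩ ζ ⁻¹' {c})) =
      μ.real (η ⁻¹' {b} ∩ ζ ⁻¹' {c}) := by
    intro b c
    rw [← sum_measureReal_inter_fiber hξ]
    refine Finset.sum_congr rfl fun a _ => ?_
    rw [inter_comm]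
  have hc : ∀ c, ∑ a, μ.real (ξ ⁻¹' {a} ∩ ζ ⁻¹' {c}) = μ.real (ζ ⁻¹' {c}) := by
    intro c
    rw [← sum_measureReal_inter_fiber hξ]
    refine Finset.sum_congr rfl fun a _ => ?_
    rw [inter_comm]
  simp only [hb, ha, hc] at h
  refine le_trans (le_of_eq ?_) (h.trans_eq ?_)
  · congr 1
    rw [partitionEntropy, Fintype.sum_prod_type]
    refine Finset.sum_congr rfl fun a _ => ?_
    rw [Fintype.sum_prod_type]
    refine Finset.sum_congr rfl fun b _ => Finset.sum_congr rfl fun c _ => ?_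
    congr 2
    ext x
    simp
  · rw [partitionEntropy_prod, partitionEntropy_prod]

theorem partitionEntropy_comp {T : Ω → Ω} (hT : MeasurePreserving T μ μ) {ξ : Ω → ι}
    (hξ : Measurable ξ) : partitionEntropy μ (fun x => ξ (T x)) = partitionEntropy μ ξ := by
  refine Finset.sum_congr rfl fun a _ => ?_
  rw [measureReal_def, measureReal_def,
    ← hT.measure_preimage (hξ (measurableSet_singleton a)).nullMeasurableSet]
  rfl

theorem measurable_itinerary {T : Ω → Ω} (hT : Measurable T) {ξ : Ω → ι} (hξ : Measurable ξ)
    (n : ℕ) : Measurable (itinerary T ξ n) :=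
  measurable_pi_lambda _ fun j => hξ.comp (hT.iterate j)

theorem itinerary_succ_eq_iff {Ω ι : Type*} {T : Ω → Ω} {ξ : Ω → ι} {n : ℕ} {x y : Ω} :
    itinerary T ξ (n + 1) x = itinerary T ξ (n + 1) y ↔
      itinerary T ξ n x = itinerary T ξ n y ∧ ξ (T^[n] x) = ξ (T^[n] y) := by
  simp only [funext_iff, itinerary, Fin.forall_fin_succ', Fin.val_castSucc, Fin.val_last]

/-- The entropy of a dynamical refinement is bounded by that of another partition, with an error
given by the conditional entropy. -/
theorem partitionEntropy_itinerary_le {T : Ω → Ω} (hT : MeasurePreserving T μ μ) {ξ : Ω → ι}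
    {η : Ω → κ} (hξ : Measurable ξ) (hη : Measurable η) (n : ℕ) :
    partitionEntropy μ (itinerary T ξ n) ≤ partitionEntropy μ (itinerary T η n) +
      n * (partitionEntropy μ (fun x => (ξ x, η x)) - partitionEntropy μ η) := by
  have hA := measurable_itinerary hT.measurable hξ
  have hB := measurable_itinerary hT.measurable hη
  -- The induction works for the joint itinerary, which is finer than that of `ξ`.
  have key : partitionEntropy μ (fun x => (itinerary T ξ n x, itinerary T η n x)) ≤
      partitionEntropy μ (itinerary T η n) +
        n * (partitionEntropy μ (fun x => (ξ x, η x)) - partitionEntropy μ η) := by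
    induction n with
    | zero =>
      rw [Nat.cast_zero, zero_mul, add_zero]
      exact partitionEntropy_le_of_factor (hB 0) ((hA 0).prodMk (hB 0))
        fun x y _ => Subsingleton.elim _ _
    | succ n ih =>
      have hTn := hT.iterate n
      have hξn : Measurable fun x => ξ (T^[n] x) := hξ.comp hTn.measurable
      have hηn : Measurable fun x => η (T^[n] x) := hη.comp hTn.measurable
      -- Conditioning on more lowers entropy. By `s1` and `s3` the new letter of `ξ` costs at most
      -- its entropy given the simultaneous letter of `η`, which by invariance is the increment in
      -- the claim; by `s2` the new letter of `η` costs no more than it does given the past of `η`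
      -- alone. The facts `f1` to `f5` only regroup tuples.
      have s1 := partitionEntropy_submodular (μ := μ) (itinerary T η (n + 1)) (hA n) hξn
      have s2 := partitionEntropy_submodular (μ := μ) (itinerary T η n) (hA n) hηn
      have s3 := partitionEntropy_submodular (μ := μ) (fun x => η (T^[n] x)) hξn (hB n)
      have i1 := partitionEntropy_comp hTn hη
      have i2 := partitionEntropy_comp hTn (hξ.prodMk hη)
      have f1 : partitionEntropy μ
          (fun x => (itinerary T ξ (n + 1) x, itinerary T η (n + 1) x)) ≤
          partitionEntropy μ
            (fun x => (itinerary T ξ n x, ξ (T^[n] x), itinerary T η (n + 1) x)) := by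
        refine partitionEntropy_le_of_factor ((hA n).prodMk (hξn.prodMk (hB (n + 1))))
          ((hA (n + 1)).prodMk (hB (n + 1))) fun x y h => ?_
        simp only [Prod.mk.injEq, itinerary_succ_eq_iff] at h ⊢
        tauto
      have f2 : partitionEntropy μ (fun x => (itinerary T ξ n x, itinerary T η (n + 1) x)) ≤
          partitionEntropy μ (fun x => (itinerary T ξ n x, η (T^[n] x), itinerary T η n x)) := by
        refine partitionEntropy_le_of_factor ((hA n).prodMk (hηn.prodMk (hB n)))
          ((hA n).prodMk (hB (n + 1))) fun x y h => ?_
        simp only [Prod.mk.injEq, itinerary_succ_eq_iff] at h ⊢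
        tauto
      have f3 : partitionEntropy μ (fun x => (η (T^[n] x), itinerary T η n x)) ≤
          partitionEntropy μ (itinerary T η (n + 1)) := by
        refine partitionEntropy_le_of_factor (hB (n + 1)) (hηn.prodMk (hB n)) fun x y h => ?_
        simp only [Prod.mk.injEq, itinerary_succ_eq_iff] at h ⊢
        tauto
      have f4 : partitionEntropy μ (fun x => (ξ (T^[n] x), itinerary T η (n + 1) x)) ≤
          partitionEntropy μ (fun x => (ξ (T^[n] x), itinerary T η n x, η (T^[n] x))) := by
        refine partitionEntropy_le_of_factor (hξn.prodMk ((hB n).prodMk hηn))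
          (hξn.prodMk (hB (n + 1))) fun x y h => ?_
        simp only [Prod.mk.injEq, itinerary_succ_eq_iff] at h ⊢
        tauto
      have f5 : partitionEntropy μ (fun x => (itinerary T η n x, η (T^[n] x))) ≤
          partitionEntropy μ (itinerary T η (n + 1)) := by
        refine partitionEntropy_le_of_factor (hB (n + 1)) ((hB n).prodMk hηn) fun x y h => ?_
        simp only [Prod.mk.injEq, itinerary_succ_eq_iff] at h ⊢
        tauto
      push_cast
      linarith
  refine (partitionEntropy_le_of_factor ((hA n).prodMk (hB n)) (hA n) fun x y h => ?_).trans key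
  exact congrArg Prod.fst h

/-- The conditional entropy is small given a partition that is close in measure. -/
theorem exists_pos_condEntropy_le {ξ : Ω → ι} (hξ : Measurable ξ) {ε : ℝ} (hε : 0 < ε) :
    ∃ δ > 0, ∀ ξ' : Ω → ι, Measurable ξ' → μ.real {x | ξ' x ≠ ξ x} < δ →
      partitionEntropy μ (fun x => (ξ x, ξ' x)) - partitionEntropy μ ξ' ≤ ε := by
  classical
  -- The conditional entropy as a function of the joint distribution. It is continuous and vanishes
  -- at `Q₀`, the distribution of the pair `(ξ, ξ)`.
  let F : (ι → ι → ℝ) → ℝ := fun Q =>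
    ∑ a, ∑ b, Real.negMulLog (Q a b) - ∑ b, Real.negMulLog (∑ a, Q a b)
  have hF : Continuous F := by
    have := Real.continuous_negMulLog
    fun_prop
  let Q₀ : ι → ι → ℝ := fun a b => if a = b then μ.real (ξ ⁻¹' {a}) else 0
  have hF0 : F Q₀ = 0 := by
    simp only [F, Q₀, sub_eq_zero]
    refine Finset.sum_congr rfl fun a _ => ?_
    rw [Finset.sum_eq_single a, Finset.sum_eq_single a]
    · intro b _ hb; rw [if_neg hb]
    · simp
    · intro b _ hb; rw [if_neg hb.symm, Real.negMulLog_zero]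
    · simp
  obtain ⟨δ, hδ, h⟩ := Metric.continuous_iff.1 hF Q₀ ε hε
  refine ⟨δ, hδ, fun ξ' hξ' hlt => ?_⟩
  have hFQ := h (fun a b => μ.real (ξ ⁻¹' {a} ∩ ξ' ⁻¹' {b})) ?_
  · rw [hF0, Real.dist_eq, sub_zero] at hFQ
    refine le_trans (le_of_eq ?_) (le_abs_self _ |>.trans hFQ.le)
    simp only [F]
    rw [partitionEntropy_prod, partitionEntropy]
    congr 1
    refine Finset.sum_congr rfl fun b _ => ?_
    rw [← sum_measureReal_inter_fiber hξ]
    simp only [inter_comm]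
  · refine (dist_pi_lt_iff hδ).2 fun a => (dist_pi_lt_iff hδ).2 fun b => ?_
    refine lt_of_le_of_lt ?_ hlt
    rw [Real.dist_eq]
    simp only [Q₀]
    split_ifs with hab
    · subst hab
      rw [abs_sub_comm, abs_of_nonneg (sub_nonneg.2 (measureReal_mono inter_subset_left))]
      refine (le_measureReal_sdiff (measure_ne_top μ _)).trans (measureReal_mono ?_)
      rintro x ⟨h1, h2⟩ h3
      exact h2 ⟨h1, h3.trans h1⟩
    · rw [sub_zero, abs_of_nonneg measureReal_nonneg]
      refine measureReal_mono ?_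
      rintro x ⟨h1, h2⟩ h3
      exact hab (by rw [← h1, ← h2, h3])

end Entropy

/-! ### Entropy of Gibbs measures -/

/-- The first letter, with all the letters from `k` on identified. -/
def truncLetter (k : ℕ) (ω : ℕ → ℕ) : Fin (k + 1) := ⟨min (ω 0) k, by omega⟩

theorem measurable_truncLetter (k : ℕ) : Measurable (truncLetter k) :=
  (measurable_of_countable fun i : ℕ => (⟨min i k, by omega⟩ : Fin (k + 1))).comp
    (measurable_pi_apply 0)

theorem itinerary_truncLetter_val (k n : ℕ) (ω : ℕ → ℕ) (j : Fin n) :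
    ((itinerary shift (truncLetter k) n ω j : Fin (k + 1)) : ℕ) = min (ω j) k := by
  simp [itinerary, truncLetter, shift_iterate_apply]

theorem itinerary_truncLetter_eq_iff {k n : ℕ} {x y : ℕ → ℕ} :
    itinerary shift (truncLetter k) n x = itinerary shift (truncLetter k) n y ↔
      ∀ j < n, min (x j) k = min (y j) k := by
  simp only [funext_iff, Fin.ext_iff, itinerary_truncLetter_val]
  exact ⟨fun h j hj => h ⟨j, hj⟩, fun h j => h j j.2⟩

theorem wordCylinder_initialWord_subset_fiber (k : ℕ) {m n : ℕ} (hmn : m ≤ n) (x : ℕ → ℕ) :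
    wordCylinder (initialWord x n) ⊆
      itinerary shift (truncLetter k) m ⁻¹' {itinerary shift (truncLetter k) m x} := by
  intro y hy
  rw [mem_preimage, mem_singleton_iff, itinerary_truncLetter_eq_iff]
  intro j hj
  have := hy j (by rw [initialWord_length]; omega)
  rw [getElem_initialWord] at this
  rw [this]

theorem eventually_fiber_eq_wordCylinder (n : ℕ) (x : ℕ → ℕ) :
    ∀ᶠ k in atTop, itinerary shift (truncLetter k) n ⁻¹' {itinerary shift (truncLetter k) n x} =
      wordCylinder (initialWord x n) := by
  -- The sum is just a bound for each of the first `n` letters; a letter below `k` is not affected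
  -- by truncation.
  filter_upwards [eventually_gt_atTop (∑ j ∈ Finset.range n, x j)] with k hk
  refine Subset.antisymm (fun y hy => ?_) (wordCylinder_initialWord_subset_fiber k le_rfl x)
  rw [mem_preimage, mem_singleton_iff, itinerary_truncLetter_eq_iff] at hy
  intro j hj
  rw [initialWord_length] at hj
  rw [getElem_initialWord]
  have h₁ := hy j hj
  have h₂ : x j ≤ ∑ j ∈ Finset.range n, x j :=
    Finset.single_le_sum (f := x) (fun _ _ => Nat.zero_le _) (Finset.mem_range.2 hj)
  omega

theorem measurable_comp_initialWord (n : ℕ) (g : List ℕ → ℝ) :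
    Measurable fun ω => g (initialWord ω n) := by
  have h : (fun ω => g (initialWord ω n)) = (fun x : Fin n → ℕ => g (List.ofFn x)) ∘
      fun ω k => ω k := by
    ext ω
    simp only [Function.comp, initialWord]
    congr 1
    exact List.ext_getElem (by simp) (by simp)
  rw [h]
  exact (measurable_of_countable _).comp (measurable_pi_lambda _ fun k => measurable_pi_apply _)

/-- Minus the logarithm of the measure of the cylinder of length `n` around a point. -/
noncomputable def info (μ : Measure (ℕ → ℕ)) (n : ℕ) (ω : ℕ → ℕ) : ℝ :=
  -Real.log (μ.real (wordCylinder (initialWord ω n)))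

theorem measurable_info (μ : Measure (ℕ → ℕ)) (n : ℕ) : Measurable (info μ n) :=
  measurable_comp_initialWord n fun w => -Real.log (μ.real (wordCylinder w))

/-- The cylinders of length `n` have, up to a bounded factor, the measures
`exp (S_n φ - n P)`. -/
structure IsGibbs (φ : (ℕ → ℕ) → ℝ) (P D : ℝ) (μ : Measure (ℕ → ℕ)) : Prop where
  pos : ∀ w, 0 < μ.real (wordCylinder w)
  abs_info_sub_le : ∀ n ω, |info μ n ω - (n * P - ∑ j ∈ Finset.range n, φ (shift^[j] ω))| ≤ D

section

variable {φ : (ℕ → ℕ) → ℝ} {P D : ℝ} {μ : Measure (ℕ → ℕ)} [IsProbabilityMeasure μ]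

theorem integrable_birkhoff (hμ : MeasurePreserving shift μ μ) (hφ : Integrable φ μ) (n : ℕ) :
    Integrable (fun ω => ∑ j ∈ Finset.range n, φ (shift^[j] ω)) μ :=
  integrable_finsetSum _ fun j _ => ((hμ.iterate j).integrable_comp hφ.1).2 hφ

theorem integral_birkhoff (hμ : MeasurePreserving shift μ μ) (hφ : Integrable φ μ) (n : ℕ) :
    ∫ ω, ∑ j ∈ Finset.range n, φ (shift^[j] ω) ∂μ = n * ∫ ω, φ ω ∂μ := by
  rw [integral_finsetSum (f := fun j ω => φ (shift^[j] ω)) _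
    fun j _ => ((hμ.iterate j).integrable_comp hφ.1).2 hφ]
  have : ∀ j, ∫ ω, φ (shift^[j] ω) ∂μ = ∫ ω, φ ω ∂μ := by
    intro j
    have h := integral_map (μ := μ) (hμ.iterate j).aemeasurable (f := φ)
      (by rw [(hμ.iterate j).map_eq]; exact hφ.1)
    rw [← h, (hμ.iterate j).map_eq]
  simp [this]

namespace IsGibbs

/-- By the Gibbs bound the information function differs from an integrable Birkhoff sum by a bounded
function. So the countable partition into cylinders has finite entropy. -/
theorem integrable_info (hG : IsGibbs φ P D μ) (hμ : MeasurePreserving shift μ μ)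
    (hφ : Integrable φ μ) (n : ℕ) : Integrable (info μ n) μ := by
  have h₁ : Integrable (fun ω => (n * P - ∑ j ∈ Finset.range n, φ (shift^[j] ω))) μ :=
    (integrable_const _).sub (integrable_birkhoff hμ hφ n)
  have h₂ : Integrable
      (fun ω => info μ n ω - (n * P - ∑ j ∈ Finset.range n, φ (shift^[j] ω))) μ :=
    Integrable.of_bound ((measurable_info μ n).aestronglyMeasurable.sub h₁.1) D
      (Eventually.of_forall fun ω => by rw [Real.norm_eq_abs]; exact hG.abs_info_sub_le n ω)
  exact (h₁.add h₂).congr (Eventually.of_forall fun ω => by simp)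

theorem abs_integral_info_sub_le (hG : IsGibbs φ P D μ) (hμ : MeasurePreserving shift μ μ)
    (hφ : Integrable φ μ) (n : ℕ) :
    |∫ ω, info μ n ω ∂μ - n * (P - ∫ ω, φ ω ∂μ)| ≤ D := by
  have h₁ : Integrable (fun ω => (n * P - ∑ j ∈ Finset.range n, φ (shift^[j] ω))) μ :=
    (integrable_const _).sub (integrable_birkhoff hμ hφ n)
  have h₂ : n * (P - ∫ ω, φ ω ∂μ) =
      ∫ ω, (n * P - ∑ j ∈ Finset.range n, φ (shift^[j] ω)) ∂μ := by
    rw [integral_sub (integrable_const _) (integrable_birkhoff hμ hφ n), integral_birkhoff hμ hφ]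
    simp
    ring
  rw [h₂, ← integral_sub (hG.integrable_info hμ hφ n) h₁]
  have := norm_integral_le_of_norm_le_const (μ := μ) (C := D)
    (Eventually.of_forall fun ω => (Real.norm_eq_abs _).trans_le (hG.abs_info_sub_le n ω))
  simpa using this

theorem partitionEntropy_le (hG : IsGibbs φ P D μ) (hμ : MeasurePreserving shift μ μ)
    (hφ : Integrable φ μ) {ι : Type*} [Fintype ι] [MeasurableSpace ι] [MeasurableSingletonClass ι]
    {ξ : (ℕ → ℕ) → ι} (hξ : Measurable ξ) (n : ℕ)
    (h : ∀ x, wordCylinder (initialWord x n) ⊆ ξ ⁻¹' {ξ x}) :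
    partitionEntropy μ ξ ≤ ∫ ω, info μ n ω ∂μ :=
  partitionEntropy_le_integral hξ (Eventually.of_forall fun _ => hG.pos _)
    (fun x => measureReal_mono (h x)) (hG.integrable_info hμ hφ n)

/-- Dominated convergence: the atoms of the truncated partitions contain the cylinder of a point, so
`info μ n` is a majorant, and they eventually equal that cylinder. -/
theorem tendsto_partitionEntropy (hG : IsGibbs φ P D μ) (hμ : MeasurePreserving shift μ μ)
    (hφ : Integrable φ μ) (n : ℕ) :
    Tendsto (fun k => partitionEntropy μ (itinerary shift (truncLetter k) n)) atTop
      (𝓝 (∫ ω, info μ n ω ∂μ)) := by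
  have hmeas := fun k => measurable_itinerary hμ.measurable (measurable_truncLetter k) n
  simp only [partitionEntropy_eq_integral (hmeas _)]
  refine tendsto_integral_of_dominated_convergence (info μ n) (fun k => ?_)
    (hG.integrable_info hμ hφ n) (fun k => Eventually.of_forall fun x => ?_)
    (Eventually.of_forall fun x => ?_)
  · exact (integrable_comp_finite (hmeas k) fun a =>
      -Real.log (μ.real (itinerary shift (truncLetter k) n ⁻¹' {a}))).1
  · have h₁ := measureReal_mono (μ := μ) (wordCylinder_initialWord_subset_fiber k (le_refl n) x)
    rw [Real.norm_of_nonneg (neg_nonneg.2 (Real.log_nonpos measureReal_nonneg measureReal_le_one))]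
    exact neg_le_neg (Real.log_le_log (hG.pos _) h₁)
  · refine tendsto_const_nhds.congr' ?_
    filter_upwards [eventually_fiber_eq_wordCylinder n x] with k hk
    rw [hk, info]

end IsGibbs

end

/-! ### Approximation of finite partitions by truncated itineraries, and the entropy formula -/

/-- The sets that depend on finitely many truncated letters. -/
def finiteItinerarySets : Set (Set (ℕ → ℕ)) :=
  {A | ∃ (N : ℕ) (S : Set (Fin N → Fin (N + 1))), A = itinerary shift (truncLetter N) N ⁻¹' S}

theorem exists_preimage_of_le {M N : ℕ} (h : M ≤ N) (S : Set (Fin M → Fin (M + 1))) :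
    ∃ S' : Set (Fin N → Fin (N + 1)), itinerary shift (truncLetter M) M ⁻¹' S =
      itinerary shift (truncLetter N) N ⁻¹' S' := by
  refine ⟨itinerary shift (truncLetter N) N '' (itinerary shift (truncLetter M) M ⁻¹' S), ?_⟩
  refine Subset.antisymm (subset_preimage_image _ _) ?_
  rintro x ⟨y, hy, hxy⟩
  rw [itinerary_truncLetter_eq_iff] at hxy
  have : itinerary shift (truncLetter M) M y = itinerary shift (truncLetter M) M x := by
    rw [itinerary_truncLetter_eq_iff]
    intro j hj
    have := hxy j (hj.trans_le h)
    omega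
  rwa [mem_preimage, ← this]

theorem isSetRing_finiteItinerarySets : IsSetRing finiteItinerarySets where
  empty_mem := ⟨0, ∅, by simp⟩
  union_mem := by
    rintro _ _ ⟨M, S, rfl⟩ ⟨N, S', rfl⟩
    obtain ⟨R, hR⟩ := exists_preimage_of_le (le_max_left M N) S
    obtain ⟨R', hR'⟩ := exists_preimage_of_le (le_max_right M N) S'
    exact ⟨max M N, R ∪ R', by rw [hR, hR', preimage_union]⟩
  sdiff_mem := by
    rintro _ _ ⟨M, S, rfl⟩ ⟨N, S', rfl⟩
    obtain ⟨R, hR⟩ := exists_preimage_of_le (le_max_left M N) S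
    obtain ⟨R', hR'⟩ := exists_preimage_of_le (le_max_right M N) S'
    exact ⟨max M N, R \ R', by rw [hR, hR', preimage_sdiff]⟩

theorem generateFrom_finiteItinerarySets :
    MeasurableSpace.generateFrom finiteItinerarySets = MeasurableSpace.pi := by
  apply le_antisymm
  · apply MeasurableSpace.generateFrom_le
    rintro _ ⟨N, S, rfl⟩
    exact measurable_itinerary measurable_shift (measurable_truncLetter N) N
      (Set.to_countable S).measurableSet
  · refine iSup_le fun k => ?_
    rintro _ ⟨s, -, rfl⟩
    have : (fun ω : ℕ → ℕ => ω k) ⁻¹' s = ⋃ i ∈ s, {ω | ω k = i} := by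
      ext ω; simp
    rw [this]
    refine MeasurableSet.biUnion (Set.to_countable s) fun i _ =>
      -- The index `k + i + 1` exceeds `k`, so that coordinate `k` is seen, and exceeds `i`, so that
      -- the letter `i` is not merged with others.
      MeasurableSpace.measurableSet_generateFrom ⟨k + i + 1, {x | (x ⟨k, by omega⟩ : ℕ) = i}, ?_⟩
    ext ω
    rw [mem_preimage, mem_ofPred_eq, mem_ofPred_eq, itinerary_truncLetter_val]
    simp only
    omega

section

variable {μ : Measure (ℕ → ℕ)} [IsProbabilityMeasure μ]

/-- A finite partition is approximated in measure by functions of finitely many truncated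
letters. -/
theorem exists_approx_itinerary {k : ℕ} {ξ : (ℕ → ℕ) → Fin k} (hξ : Measurable ξ) {δ : ℝ}
    (hδ : 0 < δ) :
    ∃ (N : ℕ) (g : (Fin N → Fin (N + 1)) → Fin k),
      μ.real {x | g (itinerary shift (truncLetter N) N x) ≠ ξ x} < δ := by
  classical
  have hk : 0 < (k : ℝ) := by
    exact_mod_cast (Nat.zero_le _).trans_lt (ξ fun _ => 0).2
  have happ : ∀ a : Fin k, ∃ (N : ℕ) (S : Set (Fin N → Fin (N + 1))),
      μ (symmDiff (itinerary shift (truncLetter N) N ⁻¹' S) (ξ ⁻¹' {a})) <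
        ENNReal.ofReal (δ / k) := by
    intro a
    obtain ⟨t, ⟨N, S, rfl⟩, h⟩ := exists_measure_symmDiff_lt_of_generateFrom_isSetRing (μ := μ)
      isSetRing_finiteItinerarySets ⟨{univ}, countable_singleton _,
        singleton_subset_iff.2 ⟨0, univ, by simp⟩, by simp⟩
      generateFrom_finiteItinerarySets.symm (hξ (measurableSet_singleton a))
      (ENNReal.ofReal_pos.2 (div_pos hδ hk))
    exact ⟨N, S, h⟩
  choose M R hR using happ
  let N := Finset.univ.sup M
  have hM : ∀ a, M a ≤ N := fun a => Finset.le_sup (Finset.mem_univ a)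
  choose S hS using fun a => exists_preimage_of_le (hM a) (R a)
  -- Outside the union of the symmetric differences exactly one `S a` contains the itinerary of `x`,
  -- namely that of `a = ξ x`. Elsewhere the choice is arbitrary.
  let g : (Fin N → Fin (N + 1)) → Fin k := fun t =>
    if h : ∃ a, t ∈ S a then h.choose else ξ fun _ => 0
  refine ⟨N, g, ?_⟩
  have hsub : {x | g (itinerary shift (truncLetter N) N x) ≠ ξ x} ⊆
      ⋃ a, symmDiff (itinerary shift (truncLetter (M a)) (M a) ⁻¹' R a) (ξ ⁻¹' {a}) := by
    intro x hx
    by_contra hcon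
    have hiff : ∀ a, itinerary shift (truncLetter N) N x ∈ S a ↔ ξ x = a := by
      intro a
      rw [← mem_preimage, ← hS a]
      have h₁ := fun h => hcon (mem_iUnion.2 ⟨a, h⟩)
      rw [mem_symmDiff] at h₁
      simp only [mem_preimage, mem_singleton_iff] at h₁ ⊢
      tauto
    have hex : ∃ a, itinerary shift (truncLetter N) N x ∈ S a := ⟨ξ x, (hiff _).2 rfl⟩
    refine hx ?_
    simp only [g]
    rw [dif_pos hex]
    exact ((hiff _).1 hex.choose_spec).symm
  calc μ.real {x | g (itinerary shift (truncLetter N) N x) ≠ ξ x}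
      ≤ μ.real (⋃ a, symmDiff (itinerary shift (truncLetter (M a)) (M a) ⁻¹' R a) (ξ ⁻¹' {a})) :=
        measureReal_mono hsub
    _ ≤ ∑ a, μ.real (symmDiff (itinerary shift (truncLetter (M a)) (M a) ⁻¹' R a) (ξ ⁻¹' {a})) :=
        measureReal_iUnion_fintype_le _
    _ < ∑ _a : Fin k, δ / k := by
        refine Finset.sum_lt_sum_of_nonempty ⟨ξ fun _ => 0, Finset.mem_univ _⟩ fun a _ => ?_
        rw [measureReal_def]
        exact (ENNReal.toReal_lt_of_lt_ofReal (hR a))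
    _ = δ := by
        rw [Finset.sum_const, Finset.card_univ, Fintype.card_fin, nsmul_eq_mul]
        field_simp

/-- A function `g` of the itinerary that is close to `ξ` already makes the conditional entropy
small, and conditioning on the whole itinerary lowers it further. -/
theorem exists_condEntropy_itinerary_le {k : ℕ} {ξ : (ℕ → ℕ) → Fin k} (hξ : Measurable ξ) {ε : ℝ}
    (hε : 0 < ε) :
    ∃ N : ℕ, partitionEntropy μ (fun x => (ξ x, itinerary shift (truncLetter N) N x)) -
      partitionEntropy μ (itinerary shift (truncLetter N) N) ≤ ε := by
  obtain ⟨δ, hδ, h⟩ := exists_pos_condEntropy_le (μ := μ) hξ hε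
  obtain ⟨N, g, hg⟩ := exists_approx_itinerary (μ := μ) hξ hδ
  have hη := measurable_itinerary measurable_shift (measurable_truncLetter N) N
  have hgη : Measurable fun x => g (itinerary shift (truncLetter N) N x) :=
    (measurable_of_finite g).comp hη
  have h₀ := h _ hgη hg
  have h₁ := partitionEntropy_submodular (μ := μ)
    (fun x => g (itinerary shift (truncLetter N) N x)) hξ hη
  have h₂ : partitionEntropy μ (fun x => (ξ x, itinerary shift (truncLetter N) N x)) ≤
      partitionEntropy μ (fun x => (ξ x, itinerary shift (truncLetter N) N x,
        g (itinerary shift (truncLetter N) N x))) := by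
    refine partitionEntropy_le_of_factor (hξ.prodMk (hη.prodMk hgη)) (hξ.prodMk hη) fun x y h => ?_
    simp only [Prod.mk.injEq] at h ⊢
    tauto
  have h₃ : partitionEntropy μ (fun x => (itinerary shift (truncLetter N) N x,
      g (itinerary shift (truncLetter N) N x))) ≤
      partitionEntropy μ (itinerary shift (truncLetter N) N) := by
    refine partitionEntropy_le_of_factor hη (hη.prodMk hgη) fun x y h => ?_
    rw [h]
  exact ⟨N, by linarith⟩

/-- The entropy formula for invariant Gibbs measures. -/
theorem IsGibbs.ksEntropy_eq {φ : (ℕ → ℕ) → ℝ} {P D : ℝ} (hG : IsGibbs φ P D μ)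
    (hμ : MeasurePreserving shift μ μ) (hφ : Integrable φ μ) :
    ksEntropy shift μ = ((P - ∫ ω, φ ω ∂μ : ℝ) : EReal) := by
  set e := P - ∫ ω, φ ω ∂μ with he
  have hI := hG.abs_integral_info_sub_le hμ hφ
  rw [← he] at hI
  apply le_antisymm
  · refine iSup_le fun k => iSup_le fun ξ => iSup_le fun hξ => ?_
    refine EReal.le_of_forall_lt_iff_le.1 fun z hz => ?_
    rw [EReal.coe_lt_coe_iff] at hz
    obtain ⟨N, hN⟩ := exists_condEntropy_itinerary_le (μ := μ) hξ (half_pos (sub_pos.2 hz))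
    have hη := measurable_itinerary measurable_shift (measurable_truncLetter N) N
    have hbound : ∀ n : ℕ, partitionEntropy μ (itinerary shift ξ n) ≤
        (n + N) * e + D + n * ((z - e) / 2) := by
      intro n
      have h₁ := partitionEntropy_itinerary_le hμ hξ hη n
      -- Looking `N` letters ahead at each of `n` times involves only the first `n + N` letters; the
      -- overhang `N` disappears after division by `n`.
      have h₂ : partitionEntropy μ (itinerary shift (itinerary shift (truncLetter N) N) n) ≤
          ∫ ω, info μ (n + N) ω ∂μ := by
        refine hG.partitionEntropy_le hμ hφ (measurable_itinerary measurable_shift hη n) _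
          fun x y hy => funext fun j => ?_
        change itinerary shift (truncLetter N) N (shift^[j] y) =
          itinerary shift (truncLetter N) N (shift^[j] x)
        rw [itinerary_truncLetter_eq_iff]
        intro i hi
        have hlt : i + (j : ℕ) < (initialWord x (n + N)).length := by
          rw [initialWord_length]
          omega
        have := hy _ hlt
        rw [getElem_initialWord] at this
        rw [shift_iterate_apply, shift_iterate_apply, this]
      have h₃ := (abs_le.1 (hI (n + N))).2
      push_cast at h₃
      have h₄ := mul_le_mul_of_nonneg_left hN (Nat.cast_nonneg (α := ℝ) n)
      linarith
    have hlim : Tendsto (fun n : ℕ => (z + e) / 2 + (N * e + D) / (n : ℝ)) atTop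
        (𝓝 ((z + e) / 2 + 0)) :=
      tendsto_const_nhds.add (tendsto_const_div_atTop_nhds_zero_nat _)
    refine limsup_le_of_le (h := ?_)
    filter_upwards [hlim.eventually_le_const (show (z + e) / 2 + 0 < z by linarith),
      eventually_gt_atTop 0] with n hn hn0
    rw [EReal.coe_le_coe_iff]
    refine le_trans ?_ hn
    have hn' : (0 : ℝ) < n := Nat.cast_pos.2 hn0
    rw [div_le_iff₀ hn', add_mul, div_mul_cancel₀ _ hn'.ne']
    linarith [hbound n]
  · refine EReal.ge_of_forall_gt_iff_ge.1 fun z hz => ?_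
    rw [EReal.coe_lt_coe_iff] at hz
    -- Fix `k` for which truncation at `k` loses at most `(e - z) / 2` of the entropy of the first
    -- letter. Given this truncation, any other truncation `l` has conditional entropy at most `(e -
    -- z) / 2`, uniformly in `l`; letting `l → ∞` recovers the full cylinders.
    have ht₁ := hG.tendsto_partitionEntropy hμ hφ 1
    obtain ⟨k, hk⟩ := (ht₁.eventually_const_le
      (show ∫ ω, info μ 1 ω ∂μ - (e - z) / 2 < ∫ ω, info μ 1 ω ∂μ by linarith)).exists
    have hα := measurable_truncLetter
    have hk' : partitionEntropy μ (itinerary shift (truncLetter k) 1) ≤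
        partitionEntropy μ (truncLetter k) :=
      partitionEntropy_le_of_factor (hα k) (measurable_itinerary measurable_shift (hα k) 1)
        fun x y h => funext fun j => by
          rw [Subsingleton.elim j 0]
          exact h
    have hpair : ∀ l, partitionEntropy μ (fun x => (truncLetter l x, truncLetter k x)) ≤
        ∫ ω, info μ 1 ω ∂μ := by
      intro l
      refine hG.partitionEntropy_le hμ hφ ((hα l).prodMk (hα k)) _ fun x y hy => ?_
      have : y 0 = x 0 := by simpa [initialWord] using hy 0 (by simp [initialWord])
      simp [truncLetter, this]
    have hbound : ∀ n : ℕ, ∫ ω, info μ n ω ∂μ ≤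
        partitionEntropy μ (itinerary shift (truncLetter k) n) + n * ((e - z) / 2) := by
      intro n
      refine le_of_tendsto' (hG.tendsto_partitionEntropy hμ hφ n) fun l => ?_
      refine (partitionEntropy_itinerary_le hμ (hα l) (hα k) n).trans ?_
      gcongr
      linarith [hpair l]
    have hlim : Tendsto (fun n : ℕ => (z + e) / 2 - D / (n : ℝ)) atTop (𝓝 ((z + e) / 2 - 0)) :=
      tendsto_const_nhds.sub (tendsto_const_div_atTop_nhds_zero_nat _)
    refine le_trans ?_ (le_iSup_of_le (k + 1) (le_iSup_of_le (truncLetter k)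
      (le_iSup_of_le (hα k) le_rfl)))
    refine le_limsup_of_frequently_le (Eventually.frequently ?_)
    filter_upwards [hlim.eventually_const_le (show z < (z + e) / 2 - 0 by linarith),
      eventually_gt_atTop 0] with n hn hn0
    rw [EReal.coe_le_coe_iff]
    refine hn.trans ?_
    have hn' : (0 : ℝ) < n := Nat.cast_pos.2 hn0
    rw [le_div_iff₀ hn', sub_mul, div_mul_cancel₀ _ hn'.ne']
    have := (abs_le.1 (hI n)).1
    linarith [hbound n]

end

/-! ### Prepending words -/

/-- The sequence that begins with the word `w` and goes on with `ω`. -/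
def prepend : List ℕ → (ℕ → ℕ) → ℕ → ℕ
  | [], ω => ω
  | i :: w, ω => fun k => Nat.casesOn k i (prepend w ω)

theorem shift_prepend_cons (i : ℕ) (w : List ℕ) (ω : ℕ → ℕ) :
    shift (prepend (i :: w) ω) = prepend w ω := rfl

theorem initialWord_prepend (w : List ℕ) (ω : ℕ → ℕ) :
    initialWord (prepend w ω) w.length = w := by
  induction w with
  | nil => rfl
  | cons i w ih => rw [List.length_cons, initialWord_succ_eq_cons, shift_prepend_cons, ih]; rfl

theorem prepend_mem_wordCylinder (w : List ℕ) (ω : ℕ → ℕ) : prepend w ω ∈ wordCylinder w :=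
  mem_wordCylinder_iff.2 (initialWord_prepend w ω)

theorem prepend_initialWord_shift (n : ℕ) (ω : ℕ → ℕ) :
    prepend (initialWord ω n) (shift^[n] ω) = ω := by
  induction n generalizing ω with
  | zero => rfl
  | succ n ih =>
    rw [initialWord_succ_eq_cons, Function.iterate_succ_apply]
    funext k
    cases k with
    | zero => rfl
    | succ k => exact congrFun (ih (shift ω)) k

theorem prepend_shift_of_mem {w : List ℕ} {ω : ℕ → ℕ} (h : ω ∈ wordCylinder w) :
    prepend w (shift^[w.length] ω) = ω := by
  have := prepend_initialWord_shift w.length ω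
  rwa [mem_wordCylinder_iff.1 h] at this

theorem prepend_eq_of_lt (w : List ℕ) (ω ω' : ℕ → ℕ) {k : ℕ} (hk : k < w.length) :
    prepend w ω k = prepend w ω' k :=
  (prepend_mem_wordCylinder w ω k hk).trans (prepend_mem_wordCylinder w ω' k hk).symm

/-- A Hölder function has exponentially small oscillations on cylinders. -/
theorem IsHolder.exists_bound {β : ℝ} {φ : (ℕ → ℕ) → ℝ} (h : IsHolder β φ) :
    ∃ B : ℝ, 0 ≤ B ∧ ∀ n : ℕ, 1 ≤ n → ∀ x y : ℕ → ℕ, (∀ k < n, x k = y k) →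
      |φ x - φ y| ≤ B * Real.exp (-β) ^ n := by
  refine ⟨_, ENNReal.toReal_nonneg (a := ⨆ (n : ℕ) (_ : 1 ≤ n),
    ENNReal.ofReal (Real.exp (β * n)) * variation φ n), fun n hn x y hxy => ?_⟩
  have h₁ : ENNReal.ofReal |φ x - φ y| ≤ variation φ n :=
    le_iSup_of_le x (le_iSup_of_le y (le_iSup_of_le hxy le_rfl))
  have h₂ : ENNReal.ofReal (Real.exp (β * n)) * ENNReal.ofReal |φ x - φ y| ≤
      ⨆ (n : ℕ) (_ : 1 ≤ n), ENNReal.ofReal (Real.exp (β * n)) * variation φ n :=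
    (mul_le_mul_right h₁ _).trans (le_iSup₂_of_le n hn le_rfl)
  rw [← ENNReal.ofReal_mul (Real.exp_nonneg _), ENNReal.ofReal_le_iff_le_toReal h.ne] at h₂
  rw [← Real.exp_nat_mul, mul_neg, mul_comm (n : ℝ) β, Real.exp_neg, ← div_eq_mul_inv,
    le_div_iff₀ (Real.exp_pos _), mul_comm]
  exact h₂

/-! ### The coding map, bounded distortion and the transfer operator -/

section IFS

variable {X : Type*} [MetricSpace X] [CompactSpace X] [Nonempty X] {f : ℕ → X → X} {s : ℝ≥0}
  {p : ℕ → C(X, ℝ)}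

theorem wordMap_lipschitzWith (hf : ∀ i, LipschitzWith s (f i)) (w : List ℕ) :
    LipschitzWith (s ^ w.length) (wordMap f w) := by
  induction w with
  | nil => simpa [wordMap] using LipschitzWith.id
  | cons i w ih => simpa [wordMap, pow_succ'] using (hf i).comp ih

/-- The right-hand side lies in all the sets whose intersection is the single coding point of `ω`.
-/
theorem codingMap_eq (hs : s < 1) (hf : ∀ i, LipschitzWith s (f i)) (ω : ℕ → ℕ) :
    codingMap f ω = f (ω 0) (codingMap f (shift ω)) := by
  have h₁ : codingMap f (shift ω) ∈ ⋂ n : ℕ, range (wordMap f (initialWord (shift ω) n)) := by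
    rw [iInter_range_wordMap hs hf]
    rfl
  have h₂ : f (ω 0) (codingMap f (shift ω)) ∈ ⋂ n : ℕ, range (wordMap f (initialWord ω n)) := by
    refine mem_iInter.2 fun n => ?_
    cases n with
    | zero => exact ⟨_, rfl⟩
    | succ n =>
      obtain ⟨y, hy⟩ := mem_iInter.1 h₁ n
      rw [initialWord_succ_eq_cons]
      exact ⟨y, by rw [← hy]; rfl⟩
  rw [iInter_range_wordMap hs hf] at h₂
  exact h₂.symm

theorem codingMap_prepend (hs : s < 1) (hf : ∀ i, LipschitzWith s (f i)) (w : List ℕ)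
    (ω : ℕ → ℕ) : codingMap f (prepend w ω) = wordMap f w (codingMap f ω) := by
  induction w with
  | nil => rfl
  | cons i w ih => rw [codingMap_eq hs hf, shift_prepend_cons, ih]; rfl

theorem potential_prepend_cons (hs : s < 1) (hf : ∀ i, LipschitzWith s (f i)) (i : ℕ)
    (w : List ℕ) (ω : ℕ → ℕ) :
    potential f p (prepend (i :: w) ω) = p i (wordMap f w (codingMap f ω)) := by
  rw [potential, shift_prepend_cons, codingMap_prepend hs hf]
  rfl

theorem wordSum_cons (i : ℕ) (w : List ℕ) (x : X) :
    wordSum f p (i :: w) x = p i (wordMap f w x) + wordSum f p w x := rfl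

/-- The bridge between the sums on `X` and the Birkhoff sums on the shift space. -/
theorem wordSum_codingMap (hs : s < 1) (hf : ∀ i, LipschitzWith s (f i)) (w : List ℕ)
    (ω : ℕ → ℕ) : wordSum f p w (codingMap f ω) =
      ∑ j ∈ Finset.range w.length, potential f p (shift^[j] (prepend w ω)) := by
  induction w with
  | nil => rfl
  | cons i w ih =>
    rw [List.length_cons, Finset.sum_range_succ', Function.iterate_zero, id,
      potential_prepend_cons hs hf, add_comm, wordSum_cons, ih]
    rfl

theorem wordSum_append (v w : List ℕ) (x : X) :
    wordSum f p (v ++ w) x = wordSum f p v (wordMap f w x) + wordSum f p w x := by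
  induction v with
  | nil => simp [wordSum]
  | cons i v ih =>
    simp only [List.cons_append, wordSum, ih, wordMap_append, Function.comp_apply, add_assoc]

theorem continuous_wordSum (hf : ∀ i, LipschitzWith s (f i)) (w : List ℕ) :
    Continuous (wordSum f p w) := by
  induction w with
  | nil => exact continuous_const
  | cons i w ih => exact ((p i).continuous.comp (wordMap_lipschitzWith hf w).continuous).add ih

/-- `K` is a closed invariant set on which the sums `S_w` oscillate by at most `D`. -/
structure HasBoundedDistortion (f : ℕ → X → X) (p : ℕ → C(X, ℝ)) (K : Set X) (D : ℝ) : Prop where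
  isClosed : IsClosed K
  codingMap_mem : ∀ ω, codingMap f ω ∈ K
  mapsTo : ∀ i, MapsTo (f i) K K
  abs_sub_le : ∀ w, ∀ x ∈ K, ∀ y ∈ K, |wordSum f p w x - wordSum f p w y| ≤ D

theorem HasBoundedDistortion.mapsTo_wordMap {K : Set X} {D : ℝ}
    (h : HasBoundedDistortion f p K D) (w : List ℕ) : MapsTo (wordMap f w) K K := by
  induction w with
  | nil => exact mapsTo_id K
  | cons i w ih => exact (h.mapsTo i).comp ih

theorem HasBoundedDistortion.nonneg {K : Set X} {D : ℝ} (h : HasBoundedDistortion f p K D) :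
    0 ≤ D :=
  (abs_nonneg _).trans
    (h.abs_sub_le [] _ (h.codingMap_mem fun _ => 0) _ (h.codingMap_mem fun _ => 0))

/-- The Hölder condition concerns only coding points. There, a letter of `w` followed by `k` further
letters contributes at most `B r ^ (k + 1)`, a geometric series; continuity extends the bound to the
closure. -/
theorem exists_hasBoundedDistortion (hs : s < 1) (hf : ∀ i, LipschitzWith s (f i)) {β : ℝ}
    (hβ : 0 < β) (hφ : IsHolder β (potential f p)) :
    ∃ K D, HasBoundedDistortion f p K D := by
  obtain ⟨B, hB, h⟩ := hφ.exists_bound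
  set r := Real.exp (-β) with hr
  have hr0 : 0 ≤ r := Real.exp_nonneg _
  have hr1 : r < 1 := by rw [hr, Real.exp_lt_one_iff]; linarith
  refine ⟨closure (range (codingMap f)), B * (1 - r)⁻¹, isClosed_closure,
    fun ω => subset_closure (mem_range_self ω), fun i => ?_, fun w => ?_⟩
  · refine MapsTo.closure ?_ (hf i).continuous
    rintro _ ⟨ω, rfl⟩
    exact ⟨prepend [i] ω, codingMap_prepend hs hf [i] ω⟩
  · have hfin : ∀ ω ω' : ℕ → ℕ,
        |wordSum f p w (codingMap f ω) - wordSum f p w (codingMap f ω')| ≤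
          ∑ k ∈ Finset.range w.length, B * r ^ (k + 1) := by
      intro ω ω'
      induction w with
      | nil => simp [wordSum]
      | cons i w ih =>
        rw [List.length_cons, Finset.sum_range_succ, wordSum_cons, wordSum_cons, add_sub_add_comm]
        refine (abs_add_le _ _).trans ?_
        rw [add_comm]
        refine add_le_add ih ?_
        rw [← potential_prepend_cons hs hf, ← potential_prepend_cons hs hf]
        -- The two sequences share the word `i :: w`, hence `w.length + 1` coordinates.
        exact h (w.length + 1) (Nat.le_add_left 1 _) _ _ fun k hk => prepend_eq_of_lt _ _ _ hk
    have hsum : ∑ k ∈ Finset.range w.length, B * r ^ (k + 1) ≤ B * (1 - r)⁻¹ := by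
      rw [← Finset.mul_sum, ← tsum_geometric_of_lt_one hr0 hr1]
      refine mul_le_mul_of_nonneg_left ?_ hB
      have hS := summable_geometric_of_lt_one hr0 hr1
      refine le_trans (Finset.sum_le_sum fun k _ => ?_) (hS.sum_le_tsum _ fun _ _ => by positivity)
      exact pow_le_pow_of_le_one hr0 hr1.le (Nat.le_succ k)
    have hcl : IsClosed {z : X × X | |wordSum f p w z.1 - wordSum f p w z.2| ≤ B * (1 - r)⁻¹} := by
      have := continuous_wordSum (p := p) hf w
      exact isClosed_le (by fun_prop) continuous_const
    intro x hx y hy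
    have hxy : (x, y) ∈ closure (range (codingMap f) ×ˢ range (codingMap f)) := by
      rw [closure_prod_eq]
      exact ⟨hx, hy⟩
    refine closure_minimal ?_ hcl hxy
    rintro ⟨_, _⟩ ⟨⟨ω, rfl⟩, ⟨ω', rfl⟩⟩
    exact (hfin ω ω').trans hsum

/-! ### The transfer operator on non-negative functions -/

/-- The operator `transfer` on functions with values in the extended non-negative reals. -/
noncomputable def ltransfer (f : ℕ → X → X) (p : ℕ → C(X, ℝ)) (g : X → ℝ≥0∞) (x : X) : ℝ≥0∞ :=
  ∑' i, ENNReal.ofReal (Real.exp (p i x)) * g (f i x)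

theorem ltransfer_iterate (n : ℕ) (g : X → ℝ≥0∞) (x : X) :
    (ltransfer f p)^[n] g x = ∑' w : {w : List ℕ // w.length = n},
      ENNReal.ofReal (Real.exp (wordSum f p w.1 x)) * g (wordMap f w.1 x) := by
  induction n generalizing g with
  | zero =>
    rw [tsum_word_zero fun w => ENNReal.ofReal (Real.exp (wordSum f p w x)) * g (wordMap f w x)]
    simp [wordSum, wordMap]
  | succ n ih =>
    rw [tsum_word_succ n
      fun w => ENNReal.ofReal (Real.exp (wordSum f p w x)) * g (wordMap f w x),
      Function.iterate_succ_apply, ih]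
    refine tsum_congr fun w => ?_
    rw [ltransfer, ← ENNReal.tsum_mul_left]
    refine tsum_congr fun i => ?_
    rw [wordSum, Real.exp_add, ENNReal.ofReal_mul (Real.exp_nonneg _)]
    simp only [wordMap, Function.comp_apply]
    ring

/-- The sum `∑_{|w| = n} exp (S_w x)`. -/
noncomputable def wordMass (f : ℕ → X → X) (p : ℕ → C(X, ℝ)) (n : ℕ) (x : X) : ℝ≥0∞ :=
  ∑' w : {w : List ℕ // w.length = n}, ENNReal.ofReal (Real.exp (wordSum f p w.1 x))

theorem ltransfer_iterate_one (n : ℕ) : (ltransfer f p)^[n] 1 = wordMass f p n := by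
  funext x
  simp [ltransfer_iterate, wordMass]

theorem wordMass_succ (n : ℕ) (x : X) :
    wordMass f p (n + 1) x =
      ∑' i, ENNReal.ofReal (Real.exp (p i x)) * wordMass f p n (f i x) := by
  rw [← ltransfer_iterate_one, Function.iterate_succ_apply', ltransfer_iterate_one]
  rfl

theorem wordMass_zero (x : X) : wordMass f p 0 x = 1 := by
  rw [← ltransfer_iterate_one]
  rfl

theorem wordMass_add (m n : ℕ) (x : X) :
    wordMass f p (m + n) x = ∑' w : {w : List ℕ // w.length = m},
      ENNReal.ofReal (Real.exp (wordSum f p w.1 x)) * wordMass f p n (wordMap f w.1 x) := by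
  rw [← ltransfer_iterate_one, Function.iterate_add_apply, ltransfer_iterate,
    ltransfer_iterate_one]

theorem wordMass_ne_top (hp : (⨆ x : X, ∑' i : ℕ, ENNReal.ofReal (Real.exp (p i x))) < ⊤) (n : ℕ)
    (x : X) : wordMass f p n x ≠ ⊤ := by
  have h : ∀ x, wordMass f p n x ≤
      (⨆ x : X, ∑' i : ℕ, ENNReal.ofReal (Real.exp (p i x))) ^ n := by
    induction n with
    | zero => intro x; rw [wordMass_zero, pow_zero]
    | succ n ih =>
      intro x
      rw [wordMass_succ, pow_succ']
      calc _ ≤ ∑' i, ENNReal.ofReal (Real.exp (p i x)) *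
            (⨆ x : X, ∑' i : ℕ, ENNReal.ofReal (Real.exp (p i x))) ^ n :=
            ENNReal.tsum_le_tsum fun i => mul_le_mul_right (ih _) _
        _ ≤ _ := by
            rw [ENNReal.tsum_mul_right]
            exact mul_le_mul_left
              (le_iSup (fun x : X => ∑' i : ℕ, ENNReal.ofReal (Real.exp (p i x))) x) _
  exact ne_top_of_le_ne_top (ENNReal.pow_ne_top hp.ne) (h x)

theorem wordMass_pos (n : ℕ) (x : X) : 0 < wordMass f p n x := by
  refine pos_iff_ne_zero.2 fun h => ?_
  rw [wordMass, ENNReal.tsum_eq_zero] at h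
  have := h ⟨List.replicate n 0, List.length_replicate⟩
  rw [ENNReal.ofReal_eq_zero] at this
  exact absurd (Real.exp_pos _) (not_lt.2 this)

namespace HasBoundedDistortion

variable {K : Set X} {D : ℝ}

theorem exp_wordSum_le (h : HasBoundedDistortion f p K D) (w : List ℕ) {x y : X} (hx : x ∈ K)
    (hy : y ∈ K) : ENNReal.ofReal (Real.exp (wordSum f p w x)) ≤
      ENNReal.ofReal (Real.exp D) * ENNReal.ofReal (Real.exp (wordSum f p w y)) := by
  rw [← ENNReal.ofReal_mul (Real.exp_nonneg _), ← Real.exp_add]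
  refine ENNReal.ofReal_le_ofReal (Real.exp_le_exp.2 ?_)
  linarith [(abs_le.1 (h.abs_sub_le w x hx y hy)).2]

theorem wordMass_le (h : HasBoundedDistortion f p K D) (n : ℕ) {x y : X} (hx : x ∈ K)
    (hy : y ∈ K) : wordMass f p n x ≤ ENNReal.ofReal (Real.exp D) * wordMass f p n y := by
  rw [wordMass, wordMass, ← ENNReal.tsum_mul_left]
  exact ENNReal.tsum_le_tsum fun w => h.exp_wordSum_le w.1 hx hy

/-- In the splitting `wordMass_add` the inner mass is taken at a point of `K`, where it agrees with
the mass at `x` up to `exp D`. -/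
theorem wordMass_add_le (h : HasBoundedDistortion f p K D) (m n : ℕ) {x : X} (hx : x ∈ K) :
    wordMass f p (m + n) x ≤
      ENNReal.ofReal (Real.exp D) * (wordMass f p m x * wordMass f p n x) := by
  rw [wordMass_add]
  calc _ ≤ ∑' w : {w : List ℕ // w.length = m}, ENNReal.ofReal (Real.exp (wordSum f p w.1 x)) *
        (ENNReal.ofReal (Real.exp D) * wordMass f p n x) :=
        ENNReal.tsum_le_tsum fun w =>
          mul_le_mul_right (h.wordMass_le n (h.mapsTo_wordMap w.1 hx) hx) _
    _ = _ := by rw [ENNReal.tsum_mul_right, ← wordMass]; ring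

theorem mul_wordMass_le (h : HasBoundedDistortion f p K D) (m n : ℕ) {x : X} (hx : x ∈ K) :
    wordMass f p m x * wordMass f p n x ≤
      ENNReal.ofReal (Real.exp D) * wordMass f p (m + n) x := by
  rw [wordMass_add, ← ENNReal.tsum_mul_left]
  calc _ = ∑' w : {w : List ℕ // w.length = m}, ENNReal.ofReal (Real.exp (wordSum f p w.1 x)) *
        wordMass f p n x := by rw [ENNReal.tsum_mul_right, ← wordMass]
    _ ≤ _ := ENNReal.tsum_le_tsum fun w => by
        rw [mul_left_comm]
        exact mul_le_mul_right (h.wordMass_le n hx (h.mapsTo_wordMap w.1 hx)) _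

end HasBoundedDistortion

end IFS

/-- A sequence that is additive up to a bounded error is linear up to a bounded error. -/
theorem exists_abs_sub_mul_le {u : ℕ → ℝ} {D : ℝ} (h : ∀ m n, |u (m + n) - (u m + u n)| ≤ D) :
    ∃ P : ℝ, ∀ n : ℕ, |u n - n * P| ≤ D := by
  -- Both `u + D` and `D - u` are subadditive. Fekete's lemma makes each growth rate an infimum, the
  -- two rates are opposite, and the two infimum inequalities are the two halves of the claim.
  have hsub₁ : Subadditive fun n => u n + D := fun m n => by
    linarith [(abs_le.1 (h m n)).2]
  have hsub₂ : Subadditive fun n => D - u n := fun m n => by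
    linarith [(abs_le.1 (h m n)).1]
  have hD : 0 ≤ D := (abs_nonneg _).trans (h 0 0)
  have h0 : |u 0| ≤ D := by
    have := h 0 0
    rw [add_zero, sub_add_cancel_left, abs_neg] at this
    exact this
  have hlin : ∀ n : ℕ, |u n| ≤ D + n * (|u 1| + D) := by
    intro n
    induction n with
    | zero => simpa using h0
    | succ n ih =>
      have := h n 1
      have h₁ := abs_add_three (u (n + 1) - (u n + u 1)) (u n) (u 1)
      rw [show u (n + 1) - (u n + u 1) + u n + u 1 = u (n + 1) by ring] at h₁
      push_cast
      linarith
  have hdiv : ∀ n : ℕ, 1 ≤ n → |u n| / n ≤ |u 1| + 2 * D := by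
    intro n hn
    have hn' : (1 : ℝ) ≤ n := by exact_mod_cast hn
    rw [div_le_iff₀ (by linarith)]
    nlinarith [hlin n]
  have hb₁ : BddBelow (range fun n : ℕ => (u n + D) / n) := by
    refine ⟨-(|u 1| + 2 * D), ?_⟩
    rintro _ ⟨n, rfl⟩
    rcases Nat.eq_zero_or_pos n with rfl | hn
    · simp only [Nat.cast_zero, div_zero]
      linarith [abs_nonneg (u 1)]
    · have h₁ := hdiv n hn
      have h₂ : -|u n| / n ≤ (u n + D) / n := by
        gcongr
        linarith [neg_abs_le (u n)]
      simp only
      rw [neg_div] at h₂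
      linarith
  have hb₂ : BddBelow (range fun n : ℕ => (D - u n) / n) := by
    refine ⟨-(|u 1| + 2 * D), ?_⟩
    rintro _ ⟨n, rfl⟩
    rcases Nat.eq_zero_or_pos n with rfl | hn
    · simp only [Nat.cast_zero, div_zero]
      linarith [abs_nonneg (u 1)]
    · have h₁ := hdiv n hn
      have h₂ : -|u n| / n ≤ (D - u n) / n := by
        gcongr
        linarith [le_abs_self (u n)]
      simp only
      rw [neg_div] at h₂
      linarith
  have hlim : hsub₂.lim = -hsub₁.lim := by
    have h₁ := (hsub₁.tendsto_lim hb₁).add (hsub₂.tendsto_lim hb₂)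
    have h₂ : Tendsto (fun n : ℕ => (u n + D) / n + (D - u n) / n) atTop (𝓝 0) :=
      (tendsto_const_div_atTop_nhds_zero_nat (2 * D)).congr fun n => by ring
    linarith [tendsto_nhds_unique h₁ h₂]
  refine ⟨hsub₁.lim, fun n => ?_⟩
  rcases Nat.eq_zero_or_pos n with rfl | hn
  · simpa using h0
  · have hn' : (0 : ℝ) < n := Nat.cast_pos.2 hn
    have h₁ := hsub₁.lim_le_div hb₁ hn.ne'
    have h₂ := hsub₂.lim_le_div hb₂ hn.ne'
    rw [hlim] at h₂
    rw [le_div_iff₀ hn'] at h₁ h₂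
    rw [abs_le]
    constructor <;> linarith

section IFS

variable {X : Type*} [MetricSpace X] [CompactSpace X] [Nonempty X] {f : ℕ → X → X} {s : ℝ≥0}
  {p : ℕ → C(X, ℝ)} {K : Set X} {D : ℝ}

/-! ### The pressure -/

namespace HasBoundedDistortion

theorem partitionFunction_le (h : HasBoundedDistortion f p K D) (hs : s < 1)
    (hf : ∀ i, LipschitzWith s (f i)) (n : ℕ) {x : X} (hx : x ∈ K) :
    partitionFunction (potential f p) n ≤ ENNReal.ofReal (Real.exp D) * wordMass f p n x := by
  rw [partitionFunction, wordMass, ← ENNReal.tsum_mul_left]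
  refine ENNReal.tsum_le_tsum fun w => iSup₂_le fun τ hτ => ?_
  have := wordSum_codingMap (p := p) hs hf w.1 (shift^[w.1.length] τ)
  rw [prepend_shift_of_mem hτ, w.2] at this
  rw [← this]
  exact h.exp_wordSum_le _ (h.codingMap_mem _) hx

theorem wordMass_le_partitionFunction (h : HasBoundedDistortion f p K D) (hs : s < 1)
    (hf : ∀ i, LipschitzWith s (f i)) (n : ℕ) {x : X} (hx : x ∈ K) :
    wordMass f p n x ≤ ENNReal.ofReal (Real.exp D) * partitionFunction (potential f p) n := by
  rw [partitionFunction, wordMass, ← ENNReal.tsum_mul_left]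
  refine ENNReal.tsum_le_tsum fun w => ?_
  refine (h.exp_wordSum_le _ hx (h.codingMap_mem fun _ => 0)).trans (mul_le_mul_right ?_ _)
  rw [wordSum_codingMap hs hf, w.2]
  exact le_iSup₂_of_le (f := fun τ (_ : τ ∈ wordCylinder w.1) => ENNReal.ofReal (Real.exp
    (∑ j ∈ Finset.range n, potential f p (shift^[j] τ)))) _ (prepend_mem_wordCylinder w.1 _) le_rfl

theorem abs_log_wordMass_add_le (h : HasBoundedDistortion f p K D)
    (hp : (⨆ x : X, ∑' i : ℕ, ENNReal.ofReal (Real.exp (p i x))) < ⊤) {x : X} (hx : x ∈ K)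
    (m n : ℕ) :
    |Real.log (wordMass f p (m + n) x).toReal -
      (Real.log (wordMass f p m x).toReal + Real.log (wordMass f p n x).toReal)| ≤ D := by
  have hpos : ∀ n, 0 < (wordMass f p n x).toReal := fun n =>
    ENNReal.toReal_pos (wordMass_pos n x).ne' (wordMass_ne_top hp n x)
  have hfin := fun n => wordMass_ne_top (f := f) hp n x
  have h₁ := ENNReal.toReal_mono (by have := hfin m; have := hfin n; finiteness)
    (h.wordMass_add_le m n hx)
  have h₂ := ENNReal.toReal_mono (by have := hfin (m + n); finiteness) (h.mul_wordMass_le m n hx)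
  rw [ENNReal.toReal_mul, ENNReal.toReal_mul, ENNReal.toReal_ofReal (Real.exp_nonneg _)] at h₁ h₂
  have h₃ := Real.log_le_log (hpos _) h₁
  have h₄ := Real.log_le_log (mul_pos (hpos m) (hpos n)) h₂
  rw [Real.log_mul (Real.exp_ne_zero _) (mul_pos (hpos m) (hpos n)).ne', Real.log_exp,
    Real.log_mul (hpos m).ne' (hpos n).ne'] at h₃
  rw [Real.log_mul (Real.exp_ne_zero _) (hpos _).ne', Real.log_exp,
    Real.log_mul (hpos m).ne' (hpos n).ne'] at h₄
  rw [abs_le]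
  constructor <;> linarith

/-- The partition function lies between `exp (n P - 2 D)` and `exp (n P + 2 D)`: one `D` comes from
`hP`, the other from comparing it with `wordMass`. `P` is left free because only this limit
identifies it with the pressure. -/
theorem tendsto_pressureSeq_of_abs_log_le (h : HasBoundedDistortion f p K D) (hs : s < 1)
    (hf : ∀ i, LipschitzWith s (f i))
    (hp : (⨆ x : X, ∑' i : ℕ, ENNReal.ofReal (Real.exp (p i x))) < ⊤) {x : X} (hx : x ∈ K)
    {P : ℝ} (hP : ∀ n : ℕ, |Real.log (wordMass f p n x).toReal - n * P| ≤ D) :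
    Tendsto (pressureSeq (potential f p)) atTop (𝓝 (P : EReal)) := by
  have hZ : ∀ n : ℕ, ENNReal.ofReal (Real.exp (n * P - 2 * D)) ≤
      partitionFunction (potential f p) n ∧ partitionFunction (potential f p) n ≤
      ENNReal.ofReal (Real.exp (n * P + 2 * D)) := by
    intro n
    have hpos := ENNReal.toReal_pos (wordMass_pos (f := f) (p := p) n x).ne' (wordMass_ne_top hp n x)
    have he : ENNReal.ofReal (Real.exp (Real.log (wordMass f p n x).toReal)) =
        wordMass f p n x := by
      rw [Real.exp_log hpos, ENNReal.ofReal_toReal (wordMass_ne_top hp n x)]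
    have hb := abs_le.1 (hP n)
    constructor
    · have h₁ := h.wordMass_le_partitionFunction hs hf n hx
      rw [← he] at h₁
      calc ENNReal.ofReal (Real.exp (n * P - 2 * D))
          ≤ ENNReal.ofReal (Real.exp (-D)) *
            ENNReal.ofReal (Real.exp (Real.log (wordMass f p n x).toReal)) := by
            rw [← ENNReal.ofReal_mul (Real.exp_nonneg _), ← Real.exp_add]
            exact ENNReal.ofReal_le_ofReal (Real.exp_le_exp.2 (by linarith))
        _ ≤ ENNReal.ofReal (Real.exp (-D)) * (ENNReal.ofReal (Real.exp D) *
            partitionFunction (potential f p) n) := mul_le_mul_right h₁ _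
        _ = _ := by
            rw [← mul_assoc, ← ENNReal.ofReal_mul (Real.exp_nonneg _), ← Real.exp_add]
            simp
    · refine (h.partitionFunction_le hs hf n hx).trans ?_
      rw [← he, ← ENNReal.ofReal_mul (Real.exp_nonneg _), ← Real.exp_add]
      exact ENNReal.ofReal_le_ofReal (Real.exp_le_exp.2 (by linarith))
  have hlog : ∀ r : ℝ, ENNReal.log (ENNReal.ofReal (Real.exp r)) = (r : EReal) := by
    intro r
    rw [ENNReal.log_pos_real' (by rw [ENNReal.toReal_ofReal (Real.exp_nonneg _)]; positivity),
      ENNReal.toReal_ofReal (Real.exp_nonneg _), Real.log_exp]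
  have hdiv : ∀ c : ℝ, Tendsto (fun n : ℕ => ((((n : ℝ) * P + c : ℝ) : EReal) / (n : EReal))) atTop
      (𝓝 (P : EReal)) := by
    intro c
    have h₁ : Tendsto (fun n : ℕ => P + c / (n : ℝ)) atTop (𝓝 (P + 0)) :=
      tendsto_const_nhds.add (tendsto_const_div_atTop_nhds_zero_nat c)
    rw [add_zero] at h₁
    refine ((continuous_coe_real_ereal.tendsto P).comp h₁).congr' ?_
    filter_upwards [eventually_gt_atTop 0] with n hn
    have hn' : (n : ℝ) ≠ 0 := by positivity
    have : P + c / (n : ℝ) = (n * P + c) / n := by field_simp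
    rw [Function.comp_apply, this, EReal.coe_div]
    rfl
  refine tendsto_of_tendsto_of_tendsto_of_le_of_le (hdiv (-(2 * D))) (hdiv (2 * D)) (fun n => ?_)
    fun n => ?_
  · refine EReal.div_le_div_right_of_nonneg (by exact_mod_cast Nat.zero_le n) ?_
    rw [← hlog, ← sub_eq_add_neg]
    exact ENNReal.log_monotone (hZ n).1
  · refine EReal.div_le_div_right_of_nonneg (by exact_mod_cast Nat.zero_le n) ?_
    rw [← hlog]
    exact ENNReal.log_monotone (hZ n).2

theorem tendsto_pressureSeq (h : HasBoundedDistortion f p K D) (hs : s < 1)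
    (hf : ∀ i, LipschitzWith s (f i))
    (hp : (⨆ x : X, ∑' i : ℕ, ENNReal.ofReal (Real.exp (p i x))) < ⊤) :
    Tendsto (pressureSeq (potential f p)) atTop (𝓝 (pressure (potential f p) : EReal)) := by
  have hx := h.codingMap_mem fun _ => 0
  obtain ⟨P, hP⟩ := exists_abs_sub_mul_le
    (u := fun n => Real.log (wordMass f p n _).toReal) (h.abs_log_wordMass_add_le hp hx)
  have := h.tendsto_pressureSeq_of_abs_log_le hs hf hp hx hP
  rw [pressure, this.limsup_eq]
  exact this

/-- The error is bounded rather than merely `o(n)`, as the construction of an eigenmeasure requires.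
-/
theorem abs_log_wordMass_sub_le (h : HasBoundedDistortion f p K D) (hs : s < 1)
    (hf : ∀ i, LipschitzWith s (f i))
    (hp : (⨆ x : X, ∑' i : ℕ, ENNReal.ofReal (Real.exp (p i x))) < ⊤) {x : X} (hx : x ∈ K)
    (n : ℕ) : |Real.log (wordMass f p n x).toReal - n * pressure (potential f p)| ≤ D := by
  obtain ⟨P, hP⟩ := exists_abs_sub_mul_le
    (u := fun n => Real.log (wordMass f p n _).toReal) (h.abs_log_wordMass_add_le hp hx)
  have := h.tendsto_pressureSeq_of_abs_log_le hs hf hp hx hP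
  rw [pressure, this.limsup_eq]
  exact hP n

theorem le_toReal_wordMass (h : HasBoundedDistortion f p K D) (hs : s < 1)
    (hf : ∀ i, LipschitzWith s (f i))
    (hp : (⨆ x : X, ∑' i : ℕ, ENNReal.ofReal (Real.exp (p i x))) < ⊤) {x : X} (hx : x ∈ K)
    (n : ℕ) : Real.exp (-D) * Real.exp (pressure (potential f p)) ^ n ≤
      (wordMass f p n x).toReal := by
  have hpos := ENNReal.toReal_pos (wordMass_pos (f := f) (p := p) n x).ne' (wordMass_ne_top hp n x)
  rw [← Real.exp_nat_mul, ← Real.exp_add, ← Real.le_log_iff_exp_le hpos]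
  linarith [(abs_le.1 (h.abs_log_wordMass_sub_le hs hf hp hx n)).1]

theorem toReal_wordMass_le (h : HasBoundedDistortion f p K D) (hs : s < 1)
    (hf : ∀ i, LipschitzWith s (f i))
    (hp : (⨆ x : X, ∑' i : ℕ, ENNReal.ofReal (Real.exp (p i x))) < ⊤) {x : X} (hx : x ∈ K)
    (n : ℕ) : (wordMass f p n x).toReal ≤
      Real.exp D * Real.exp (pressure (potential f p)) ^ n := by
  have hpos := ENNReal.toReal_pos (wordMass_pos (f := f) (p := p) n x).ne' (wordMass_ne_top hp n x)
  rw [← Real.exp_nat_mul, ← Real.exp_add, ← Real.log_le_iff_le_exp hpos]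
  linarith [(abs_le.1 (h.abs_log_wordMass_sub_le hs hf hp hx n)).2]

end HasBoundedDistortion

end IFS

/-! ### Eigenmeasures of positive operators -/

/-- A normalized positive functional on the continuous functions of a compact space is the integral
for a probability measure. -/
theorem exists_isProbabilityMeasure_integral_eq {Y : Type*} [TopologicalSpace Y] [T2Space Y]
    [CompactSpace Y] [MeasurableSpace Y] [BorelSpace Y] (Λ : C(Y, ℝ) →ₗ[ℝ] ℝ)
    (hΛ : ∀ g : C(Y, ℝ), 0 ≤ g → 0 ≤ Λ g) (hΛ1 : Λ 1 = 1) :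
    ∃ m : Measure Y, IsProbabilityMeasure m ∧ ∀ g : C(Y, ℝ), ∫ x, g x ∂m = Λ g := by
  let Λ' : CompactlySupportedContinuousMap Y ℝ →ₚ[ℝ] ℝ :=
    { toFun := fun g => Λ g.toContinuousMap
      map_add' := fun g g' => Λ.map_add g.toContinuousMap g'.toContinuousMap
      map_smul' := fun c g => Λ.map_smul c g.toContinuousMap
      monotone' := fun g g' hgg' => by
        have h₁ := hΛ (g'.toContinuousMap - g.toContinuousMap) fun x => sub_nonneg.2 (hgg' x)
        rw [map_sub, sub_nonneg] at h₁
        exact h₁ }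
  have hint : ∀ g : C(Y, ℝ), ∫ x, g x ∂(RealRMK.rieszMeasure Λ') = Λ g := fun g =>
    RealRMK.integral_rieszMeasure Λ' ⟨g, HasCompactSupport.of_compactSpace _⟩
  refine ⟨RealRMK.rieszMeasure Λ', ⟨?_⟩, hint⟩
  have h₁ := hint 1
  rw [hΛ1] at h₁
  simpa [measureReal_def, ENNReal.toReal_eq_one_iff] using h₁

/-- A positive operator on the continuous functions of a compact space whose powers grow, at one
point and up to a bounded factor, like those of `lam` has an eigenmeasure for `lam`. -/
theorem exists_eigenmeasure_of_positive {Y : Type*} [TopologicalSpace Y] [T2Space Y]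
    [CompactSpace Y] [MeasurableSpace Y] [BorelSpace Y] (T : C(Y, ℝ) →ₗ[ℝ] C(Y, ℝ))
    (hT : ∀ g : C(Y, ℝ), 0 ≤ g → 0 ≤ T g) {lam c C : ℝ} (hlam : 0 < lam) (hc : 0 < c) (y : Y)
    (hle : ∀ n : ℕ, c * lam ^ n ≤ (T ^ n) 1 y) (hge : ∀ n : ℕ, (T ^ n) 1 y ≤ C * lam ^ n) :
    ∃ m : Measure Y, IsProbabilityMeasure m ∧
      ∀ g : C(Y, ℝ), ∫ x, T g x ∂m = lam * ∫ x, g x ∂m := by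
  have hTn : ∀ (n : ℕ) (g : C(Y, ℝ)), 0 ≤ g → 0 ≤ (T ^ n) g := by
    intro n
    induction n with
    | zero => intro g hg; simpa using hg
    | succ n ih =>
      intro g hg
      rw [pow_succ, Module.End.mul_apply]
      exact ih _ (hT g hg)
  have hTabs : ∀ (n : ℕ) (g : C(Y, ℝ)), |(T ^ n) g y| ≤ ‖g‖ * (T ^ n) 1 y := by
    intro n g
    have h₁ := hTn n (‖g‖ • 1 - g) fun x => by
      simpa using (le_abs_self (g x)).trans (g.norm_coe_le_norm x)
    have h₂ := hTn n (‖g‖ • 1 + g) fun x => by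
      change (0 : ℝ) ≤ ‖g‖ * 1 + g x
      have := neg_abs_le (g x)
      have h₃ := g.norm_coe_le_norm x
      rw [Real.norm_eq_abs] at h₃
      linarith
    have h₁' : 0 ≤ ‖g‖ * (T ^ n) 1 y - (T ^ n) g y := by
      rw [map_sub, map_smul] at h₁
      exact h₁ y
    have h₂' : 0 ≤ ‖g‖ * (T ^ n) 1 y + (T ^ n) g y := by
      rw [map_add, map_smul] at h₂
      exact h₂ y
    rw [abs_le]
    constructor <;> linarith
  -- Sums of the functionals `lam⁻ⁿ (T^*)ⁿ δ_y`. The lower growth bound makes their mass at least `c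
  -- N`.
  let S : ℕ → C(Y, ℝ) →ₗ[ℝ] ℝ := fun N =>
    ∑ n ∈ Finset.range N, (lam ^ n)⁻¹ • (ContinuousMap.evalCLM ℝ y).toLinearMap ∘ₗ (T ^ n)
  have hS : ∀ N g, S N g = ∑ n ∈ Finset.range N, (lam ^ n)⁻¹ * (T ^ n) g y := by
    intro N g
    simp [S]
  have hS1 : ∀ N : ℕ, c * N ≤ S N 1 := by
    intro N
    rw [hS]
    calc c * N = ∑ n ∈ Finset.range N, c := by
          rw [Finset.sum_const, Finset.card_range, nsmul_eq_mul, mul_comm]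
      _ ≤ _ := Finset.sum_le_sum fun n _ => by
          rw [inv_mul_eq_div, le_div_iff₀ (by positivity)]
          exact hle n
  have hSpos : ∀ N : ℕ, 0 < S (N + 1) 1 := fun N =>
    lt_of_lt_of_le (by positivity) (hS1 (N + 1))
  have hSabs : ∀ N g, |S N g| ≤ ‖g‖ * S N 1 := by
    intro N g
    rw [hS, hS, Finset.mul_sum]
    refine (Finset.abs_sum_le_sum_abs _ _).trans (Finset.sum_le_sum fun n _ => ?_)
    rw [abs_mul, abs_of_pos (by positivity : 0 < (lam ^ n)⁻¹), mul_left_comm]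
    exact mul_le_mul_of_nonneg_left (hTabs n g) (by positivity)
  let F : ℕ → C(Y, ℝ) →ₗ[ℝ] ℝ := fun N => (S (N + 1) 1)⁻¹ • S (N + 1)
  have hFabs : ∀ N g, F N g ∈ Icc (-‖g‖) ‖g‖ := by
    intro N g
    rw [mem_Icc, ← abs_le]
    simp only [F, LinearMap.smul_apply, smul_eq_mul]
    rw [abs_mul, abs_of_pos (inv_pos.2 (hSpos N)), inv_mul_eq_div, div_le_iff₀ (hSpos N)]
    exact hSabs (N + 1) g
  have hex : ∀ g, ∃ x ∈ Icc (-‖g‖) ‖g‖, Tendsto (fun N => F N g) (hyperfilter ℕ) (𝓝 x) := by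
    intro g
    refine isCompact_Icc.ultrafilter_le_nhds ((hyperfilter ℕ).map fun N => F N g) ?_
    rw [Ultrafilter.coe_map, le_principal_iff, mem_map]
    exact univ_mem' fun N => hFabs N g
  choose ℓ _ hℓ using hex
  let Λ : C(Y, ℝ) →ₗ[ℝ] ℝ :=
    { toFun := ℓ
      map_add' := fun g g' => tendsto_nhds_unique (hℓ (g + g'))
        (((hℓ g).add (hℓ g')).congr fun N => (map_add (F N) g g').symm)
      map_smul' := fun a g => tendsto_nhds_unique (hℓ (a • g))
        (((hℓ g).const_smul a).congr fun N => (map_smul (F N) a g).symm) }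
  have hΛ : ∀ g : C(Y, ℝ), 0 ≤ g → 0 ≤ Λ g := by
    intro g hg
    refine ge_of_tendsto' (hℓ g) fun N => ?_
    simp only [F, LinearMap.smul_apply, smul_eq_mul]
    refine mul_nonneg (inv_pos.2 (hSpos N)).le ?_
    rw [hS]
    exact Finset.sum_nonneg fun n _ => mul_nonneg (by positivity) (hTn n g hg y)
  have hΛ1 : Λ 1 = 1 := by
    refine tendsto_nhds_unique (hℓ 1) (tendsto_const_nhds.congr fun N => ?_)
    simp only [F, LinearMap.smul_apply, smul_eq_mul]
    rw [inv_mul_cancel₀ (hSpos N).ne']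
  obtain ⟨m, hm, hint⟩ := exists_isProbabilityMeasure_integral_eq Λ hΛ hΛ1
  refine ⟨m, hm, fun g => ?_⟩
  rw [hint, hint]
  -- The difference telescopes to boundary terms, bounded by the upper growth estimate, and is
  -- divided by a mass of at least `c (N + 1)`.
  have hlim : Tendsto (fun N => F N (T g) - lam * F N g) (hyperfilter ℕ : Filter ℕ) (𝓝 0) := by
    refine Tendsto.mono_left ?_ Nat.hyperfilter_le_atTop
    refine squeeze_zero_norm
      (a := fun N : ℕ => lam * (‖g‖ * (C + 1)) / c * (1 / ((N : ℝ) + 1))) (fun N => ?_) ?_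
    · have htel : S (N + 1) (T g) - lam * S (N + 1) g =
          lam * ((lam ^ (N + 1))⁻¹ * (T ^ (N + 1)) g y - g y) := by
        rw [hS, hS, Finset.mul_sum, ← Finset.sum_sub_distrib]
        have h₁ := Finset.sum_range_sub (fun n => (lam ^ n)⁻¹ * (T ^ n) g y) (N + 1)
        rw [pow_zero, pow_zero, inv_one, one_mul, Module.End.one_apply] at h₁
        rw [← h₁, Finset.mul_sum]
        refine Finset.sum_congr rfl fun n _ => ?_
        rw [pow_succ T, Module.End.mul_apply, pow_succ]
        field_simp
      have hb : |(lam ^ (N + 1))⁻¹ * (T ^ (N + 1)) g y - g y| ≤ ‖g‖ * (C + 1) := by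
        refine (abs_sub _ _).trans ?_
        have h₁ : |(lam ^ (N + 1))⁻¹ * (T ^ (N + 1)) g y| ≤ ‖g‖ * C := by
          rw [abs_mul, abs_of_pos (by positivity : 0 < (lam ^ (N + 1))⁻¹), inv_mul_eq_div,
            div_le_iff₀ (by positivity), mul_assoc]
          exact (hTabs _ g).trans (mul_le_mul_of_nonneg_left (hge _) (norm_nonneg _))
        have h₂ := g.norm_coe_le_norm y
        rw [Real.norm_eq_abs] at h₂
        linarith
      simp only [F, LinearMap.smul_apply, smul_eq_mul]
      rw [mul_left_comm, ← mul_sub, htel, norm_mul, norm_inv, Real.norm_of_nonneg (hSpos N).le,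
        Real.norm_eq_abs, abs_mul, abs_of_pos hlam, inv_mul_eq_div, div_mul_div_comm, mul_one]
      have h₁ := hS1 (N + 1)
      push_cast at h₁
      gcongr
      exact mul_nonneg hlam.le ((abs_nonneg _).trans hb)
    · have := tendsto_one_div_add_atTop_nhds_zero_nat (𝕜 := ℝ).const_mul
        (lam * (‖g‖ * (C + 1)) / c)
      rwa [mul_zero] at this
  have := tendsto_nhds_unique hlim ((hℓ (T g)).sub ((hℓ g).const_mul lam))
  exact (sub_eq_zero.1 this.symm)

section IFS

variable {X : Type*} [MetricSpace X] [CompactSpace X] [Nonempty X] {f : ℕ → X → X} {s : ℝ≥0}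
  {p : ℕ → C(X, ℝ)} {K : Set X} {D : ℝ}

/-! ### Existence of eigenmeasures -/

theorem summable_exp (hp : (⨆ x : X, ∑' i : ℕ, ENNReal.ofReal (Real.exp (p i x))) < ⊤) (x : X) :
    Summable fun i => Real.exp (p i x) := by
  have h : ∑' i : ℕ, ENNReal.ofReal (Real.exp (p i x)) ≠ ⊤ :=
    ((le_iSup (fun x : X => ∑' i : ℕ, ENNReal.ofReal (Real.exp (p i x))) x).trans_lt hp).ne
  exact (ENNReal.summable_toReal h).congr fun i => ENNReal.toReal_ofReal (Real.exp_nonneg _)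

theorem HasBoundedDistortion.abs_sub_le_letter (h : HasBoundedDistortion f p K D) (i : ℕ) {x y : X}
    (hx : x ∈ K) (hy : y ∈ K) : |p i x - p i y| ≤ D := by
  have := h.abs_sub_le [i] x hx y hy
  simpa [wordSum, wordMap] using this

theorem HasBoundedDistortion.exp_letter_le (h : HasBoundedDistortion f p K D) (i : ℕ) {x y : X}
    (hx : x ∈ K) (hy : y ∈ K) : Real.exp (p i x) ≤ Real.exp D * Real.exp (p i y) := by
  rw [← Real.exp_add]
  exact Real.exp_le_exp.2 (by linarith [(abs_le.1 (h.abs_sub_le_letter i hx hy)).2])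

/-- The transfer operator as an operator on the continuous functions on `K`. -/
theorem HasBoundedDistortion.exists_transfer_restrict (h : HasBoundedDistortion f p K D)
    (hf : ∀ i, LipschitzWith s (f i))
    (hp : (⨆ x : X, ∑' i : ℕ, ENNReal.ofReal (Real.exp (p i x))) < ⊤) :
    ∃ T : C(K, ℝ) →ₗ[ℝ] C(K, ℝ), ∀ (g : C(K, ℝ)) (y : K),
      T g y = ∑' i, Real.exp (p i y) * g ⟨f i y, h.mapsTo i y.2⟩ := by
  have hx := h.codingMap_mem fun _ => 0
  set x := codingMap f fun _ => 0
  have hK : CompactSpace K := isCompact_iff_compactSpace.1 h.isClosed.isCompact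
  -- Distortion gives a summable majorant independent of `y`, hence a continuous sum. On all of `X`
  -- the hypotheses only bound the sum, which is why the operator is restricted to `K`.
  have hbound : ∀ (g : C(K, ℝ)) (i : ℕ) (y : K),
      ‖Real.exp (p i y) * g ⟨f i y, h.mapsTo i y.2⟩‖ ≤
        Real.exp D * Real.exp (p i x) * ‖g‖ := by
    intro g i y
    rw [norm_mul, Real.norm_of_nonneg (Real.exp_nonneg _)]
    exact mul_le_mul (h.exp_letter_le i y.2 hx) (g.norm_coe_le_norm _) (norm_nonneg _)
      (by positivity)
  have hsum : ∀ g : C(K, ℝ), Summable fun i => Real.exp D * Real.exp (p i x) * ‖g‖ := fun g =>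
    ((summable_exp hp x).mul_left _).mul_right _
  have hsum' : ∀ (g : C(K, ℝ)) (y : K),
      Summable fun i => Real.exp (p i y) * g ⟨f i y, h.mapsTo i y.2⟩ := fun g y =>
    Summable.of_norm_bounded (hsum g) fun i => hbound g i y
  refine ⟨{ toFun := fun g => ⟨fun y => ∑' i, Real.exp (p i y) * g ⟨f i y, h.mapsTo i y.2⟩,
    continuous_tsum (fun i => ?_) (hsum g) (hbound g)⟩, map_add' := ?_, map_smul' := ?_ },
    fun g y => rfl⟩
  · have := (hf i).continuous
    have h₁ : Continuous fun y : K => (⟨f i y, h.mapsTo i y.2⟩ : K) := by fun_prop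
    have h₂ := (p i).continuous
    fun_prop
  · intro g g'
    ext y
    simp only [ContinuousMap.coe_mk, ContinuousMap.add_apply, mul_add]
    exact (hsum' g y).tsum_add (hsum' g' y)
  · intro a g
    ext y
    simp only [ContinuousMap.coe_mk, ContinuousMap.smul_apply, smul_eq_mul, RingHom.id_apply]
    rw [← tsum_mul_left]
    exact tsum_congr fun i => by ring

variable [MeasurableSpace X] [BorelSpace X]

/-- On `K` the powers of the operator applied to `1` are the word masses, which grow like `exp (n
P)`. The eigenmeasure found there is pushed forward to `X`. -/
theorem HasBoundedDistortion.exists_isEigenmeasure (h : HasBoundedDistortion f p K D) (hs : s < 1)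
    (hf : ∀ i, LipschitzWith s (f i))
    (hp : (⨆ x : X, ∑' i : ℕ, ENNReal.ofReal (Real.exp (p i x))) < ⊤) :
    ∃ m : Measure X, IsEigenmeasure f p m ∧
      ∫ x, transfer f p 1 x ∂m = Real.exp (pressure (potential f p)) := by
  obtain ⟨T, hT⟩ := h.exists_transfer_restrict hf hp
  have hx := h.codingMap_mem fun _ => 0
  have hTn : ∀ (n : ℕ) (y : K), (T ^ n) 1 y = (wordMass f p n y).toReal := by
    intro n
    induction n with
    | zero => intro y; rw [wordMass_zero, pow_zero]; rfl
    | succ n ih =>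
      intro y
      rw [pow_succ', Module.End.mul_apply, hT, wordMass_succ, ENNReal.tsum_toReal_eq fun i =>
        ENNReal.mul_ne_top ENNReal.ofReal_ne_top (wordMass_ne_top hp n _)]
      refine tsum_congr fun i => ?_
      rw [ih, ENNReal.toReal_mul, ENNReal.toReal_ofReal (Real.exp_nonneg _)]
  have : CompactSpace K := isCompact_iff_compactSpace.1 h.isClosed.isCompact
  obtain ⟨m, hm, hint⟩ := exists_eigenmeasure_of_positive T
    (fun g hg y => by
      change (0 : ℝ) ≤ T g y
      rw [hT]
      exact tsum_nonneg fun i => mul_nonneg (Real.exp_nonneg _) (hg _))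
    (Real.exp_pos (pressure (potential f p))) (Real.exp_pos (-D)) ⟨_, hx⟩
    (fun n => by rw [hTn]; exact h.le_toReal_wordMass hs hf hp hx n)
    (C := Real.exp D) (fun n => by rw [hTn]; exact h.toReal_wordMass_le hs hf hp hx n)
  have hemb : MeasurableEmbedding (Subtype.val : K → X) :=
    MeasurableEmbedding.subtype_coe h.isClosed.measurableSet
  have hmap : ∀ g : C(X, ℝ), ∫ x, transfer f p g x ∂(m.map Subtype.val) =
      Real.exp (pressure (potential f p)) * ∫ x, g x ∂(m.map Subtype.val) := by
    intro g
    rw [hemb.integral_map, hemb.integral_map]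
    have h₁ := hint (g.comp ⟨Subtype.val, continuous_subtype_val⟩)
    simp only [hT] at h₁
    exact h₁
  have hprob : IsProbabilityMeasure (m.map (Subtype.val : K → X)) :=
    Measure.isProbabilityMeasure_map hemb.measurable.aemeasurable
  have hone : ∫ x, transfer f p 1 x ∂(m.map Subtype.val) =
      Real.exp (pressure (potential f p)) := by
    rw [hmap]
    simp
  exact ⟨m.map Subtype.val, ⟨hprob, fun g => by rw [hone, hmap]⟩, hone⟩

/-! ### Properties of eigenmeasures -/

theorem measurable_ltransfer (hf : ∀ i, LipschitzWith s (f i)) {g : X → ℝ≥0∞}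
    (hg : Measurable g) : Measurable (ltransfer f p g) := by
  refine Measurable.tsum fun i => ?_
  have h₁ := (hf i).continuous.measurable
  have h₂ := (p i).continuous.measurable
  exact (Real.measurable_exp.comp h₂).ennreal_ofReal.mul (hg.comp h₁)

theorem measurable_ltransfer_iterate (hf : ∀ i, LipschitzWith s (f i)) {g : X → ℝ≥0∞}
    (hg : Measurable g) (n : ℕ) : Measurable ((ltransfer f p)^[n] g) := by
  induction n with
  | zero => exact hg
  | succ n ih =>
    rw [Function.iterate_succ_apply']
    exact measurable_ltransfer hf ih

theorem measurable_wordMass (hf : ∀ i, LipschitzWith s (f i)) (n : ℕ) :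
    Measurable (wordMass f p n) := by
  rw [← ltransfer_iterate_one]
  exact measurable_ltransfer_iterate hf measurable_one n

theorem ofReal_transfer (hp : (⨆ x : X, ∑' i : ℕ, ENNReal.ofReal (Real.exp (p i x))) < ⊤)
    (g : C(X, ℝ)) (hg : 0 ≤ g) (x : X) :
    ENNReal.ofReal (transfer f p g x) = ltransfer f p (fun y => ENNReal.ofReal (g y)) x := by
  have hs : Summable fun i => Real.exp (p i x) * g (f i x) := by
    refine Summable.of_norm_bounded ((summable_exp hp x).mul_right ‖g‖) fun i => ?_
    rw [norm_mul, Real.norm_of_nonneg (Real.exp_nonneg _)]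
    exact mul_le_mul_of_nonneg_left (g.norm_coe_le_norm _) (Real.exp_nonneg _)
  have hnn : ∀ i, 0 ≤ Real.exp (p i x) * g (f i x) := fun i =>
    mul_nonneg (Real.exp_nonneg _) (hg _)
  rw [transfer, ENNReal.ofReal_tsum_of_nonneg hnn hs]
  exact tsum_congr fun i => ENNReal.ofReal_mul (Real.exp_nonneg _)

namespace IsEigenmeasure

variable {m : Measure X}

/-- The eigenvalue equation holds for all non-negative measurable functions. -/
theorem lintegral_ltransfer (hm : IsEigenmeasure f p m) (hf : ∀ i, LipschitzWith s (f i))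
    (hp : (⨆ x : X, ∑' i : ℕ, ENNReal.ofReal (Real.exp (p i x))) < ⊤) {g : X → ℝ≥0∞}
    (hg : Measurable g) :
    ∫⁻ x, ltransfer f p g x ∂m = ENNReal.ofReal (∫ x, transfer f p 1 x ∂m) * ∫⁻ x, g x ∂m := by
  have := hm.1
  have hexp : ∀ i, Measurable fun x => ENNReal.ofReal (Real.exp (p i x)) := fun i =>
    (Real.measurable_exp.comp (p i).continuous.measurable).ennreal_ofReal
  -- The functional `g ↦ ∫ L g dm` as a measure. Agreement with a multiple of `m` on continuous
  -- functions then gives equality of measures.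
  let M : Measure X := Measure.sum fun i =>
    (m.withDensity fun x => ENNReal.ofReal (Real.exp (p i x))).map (f i)
  have hM : ∀ g : X → ℝ≥0∞, Measurable g → ∫⁻ x, g x ∂M = ∫⁻ x, ltransfer f p g x ∂m := by
    intro g hg
    have hfi := fun i => (hf i).continuous.measurable
    simp only [M, ltransfer]
    rw [lintegral_sum_measure,
      lintegral_tsum (f := fun i x => ENNReal.ofReal (Real.exp (p i x)) * g (f i x)) fun i =>
        ((hexp i).mul (hg.comp (hfi i))).aemeasurable]
    refine tsum_congr fun i => ?_
    rw [lintegral_map hg (hfi i)]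
    exact lintegral_withDensity_eq_lintegral_mul _ (hexp i) (hg.comp (hfi i))
  have hbound : ∀ g : C(X, ℝ), ∫⁻ x, ltransfer f p (fun y => ENNReal.ofReal (g y)) x ∂m ≠ ⊤ := by
    intro g
    refine ne_top_of_le_ne_top (b := ENNReal.ofReal ‖g‖ *
      ⨆ x : X, ∑' i : ℕ, ENNReal.ofReal (Real.exp (p i x)))
      (ENNReal.mul_ne_top ENNReal.ofReal_ne_top hp.ne) ?_
    refine (lintegral_mono (g := fun _ => ENNReal.ofReal ‖g‖ *
      ⨆ x : X, ∑' i : ℕ, ENNReal.ofReal (Real.exp (p i x))) fun x => ?_).trans (by simp)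
    refine le_trans ?_ (mul_le_mul_right
      (le_iSup (fun x : X => ∑' i : ℕ, ENNReal.ofReal (Real.exp (p i x))) x) _)
    rw [ltransfer, ← ENNReal.tsum_mul_left]
    refine ENNReal.tsum_le_tsum fun i => ?_
    rw [mul_comm]
    exact mul_le_mul_left (ENNReal.ofReal_le_ofReal
      ((le_abs_self _).trans (g.norm_coe_le_norm _))) _
  have hcont : ∀ g : C(X, ℝ), 0 ≤ g → ∫⁻ x, ENNReal.ofReal (g x) ∂M =
      ENNReal.ofReal (∫ x, transfer f p 1 x ∂m) * ∫⁻ x, ENNReal.ofReal (g x) ∂m := by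
    intro g hg
    have hgm : Measurable fun x => ENNReal.ofReal (g x) := g.continuous.measurable.ennreal_ofReal
    have hnn : ∀ x, 0 ≤ transfer f p g x := fun x =>
      tsum_nonneg fun i => mul_nonneg (Real.exp_nonneg _) (hg _)
    have hmeas : Measurable (transfer f p g) := by
      have : transfer f p g = fun x => (ltransfer f p (fun y => ENNReal.ofReal (g y)) x).toReal :=
        funext fun x => by rw [← ofReal_transfer hp g hg, ENNReal.toReal_ofReal (hnn x)]
      rw [this]
      exact (measurable_ltransfer hf hgm).ennreal_toReal
    have hgi : Integrable (fun x => g x) m :=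
      g.continuous.integrable_of_hasCompactSupport (HasCompactSupport.of_compactSpace _)
    have h1 : 0 ≤ ∫ x, transfer f p 1 x ∂m := integral_nonneg fun x =>
      tsum_nonneg fun i => mul_nonneg (Real.exp_nonneg _) zero_le_one
    rw [hM _ hgm, ← ofReal_integral_eq_lintegral_ofReal hgi (Eventually.of_forall hg),
      ← ENNReal.ofReal_mul h1, ← hm.2 g,
      integral_eq_lintegral_of_nonneg_ae (Eventually.of_forall hnn) hmeas.aestronglyMeasurable]
    simp only [ofReal_transfer hp g hg]
    rw [ENNReal.ofReal_toReal (hbound g)]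
  have hMfin : IsFiniteMeasure M := by
    constructor
    have h₁ := hcont 1 zero_le_one
    have h₂ := hbound 1
    simp only [ContinuousMap.one_apply, ENNReal.ofReal_one, lintegral_one, measure_univ] at h₁
    rw [h₁]
    finiteness
  have hext : M = ENNReal.ofReal (∫ x, transfer f p 1 x ∂m) • m := by
    have : IsFiniteMeasure (ENNReal.ofReal (∫ x, transfer f p 1 x ∂m) • m) :=
      Measure.smul_finite m ENNReal.ofReal_ne_top
    refine ext_of_forall_lintegral_eq_of_IsFiniteMeasure fun g => ?_
    have h₁ := hcont ⟨fun x => (g x : ℝ), by fun_prop⟩ fun x => (g x).2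
    simp only [ContinuousMap.coe_mk, ENNReal.ofReal_coe_nnreal] at h₁
    rw [h₁, lintegral_smul_measure, smul_eq_mul]
  rw [← hM g hg, hext, lintegral_smul_measure, smul_eq_mul]

theorem lintegral_ltransfer_iterate (hm : IsEigenmeasure f p m) (hf : ∀ i, LipschitzWith s (f i))
    (hp : (⨆ x : X, ∑' i : ℕ, ENNReal.ofReal (Real.exp (p i x))) < ⊤) {g : X → ℝ≥0∞}
    (hg : Measurable g) (n : ℕ) :
    ∫⁻ x, (ltransfer f p)^[n] g x ∂m =
      ENNReal.ofReal (∫ x, transfer f p 1 x ∂m) ^ n * ∫⁻ x, g x ∂m := by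
  induction n with
  | zero => simp
  | succ n ih =>
    rw [Function.iterate_succ_apply', hm.lintegral_ltransfer hf hp (measurable_ltransfer_iterate hf hg n), ih, pow_succ']
    ring

/-- Test with the distance to `K`. A word of length `n` maps `X` into the `sⁿ diam X`-neighbourhood
of `K`, so the `n`-th power of the operator gives at most `sⁿ diam X` times its value at `1`.
Integrating cancels `lamⁿ`, and `n → ∞` makes the mean distance zero. -/
theorem ae_mem (hm : IsEigenmeasure f p m) (h : HasBoundedDistortion f p K D) (hs : s < 1)
    (hf : ∀ i, LipschitzWith s (f i))
    (hp : (⨆ x : X, ∑' i : ℕ, ENNReal.ofReal (Real.exp (p i x))) < ⊤) : ∀ᵐ x ∂m, x ∈ K := by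
  have := hm.1
  set lam := ENNReal.ofReal (∫ x, transfer f p 1 x ∂m) with hlam
  have hmass : ∀ n, ∫⁻ x, wordMass f p n x ∂m = lam ^ n := by
    intro n
    have := hm.lintegral_ltransfer_iterate hf hp (g := 1) measurable_one n
    rw [ltransfer_iterate_one] at this
    simpa using this
  have hdist : Measurable fun x => Metric.infEDist x K := Metric.continuous_infEDist.measurable
  have hK : K.Nonempty := ⟨_, h.codingMap_mem fun _ => 0⟩
  have hdiam : Metric.ediam (univ : Set X) ≠ ⊤ := isCompact_univ.isBounded.ediam_ne_top
  have hcontr : ∀ n x, (ltransfer f p)^[n] (fun x => Metric.infEDist x K) x ≤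
      (s : ℝ≥0∞) ^ n * Metric.ediam (univ : Set X) * wordMass f p n x := by
    intro n x
    rw [ltransfer_iterate, wordMass, ← ENNReal.tsum_mul_left]
    refine ENNReal.tsum_le_tsum fun w => ?_
    rw [mul_comm]
    refine mul_le_mul_left ?_ _
    have h₁ := wordMap_lipschitzWith hf w.1 x hK.some
    rw [w.2] at h₁
    push_cast at h₁
    exact (Metric.infEDist_le_edist_of_mem (h.mapsTo_wordMap w.1 hK.some_mem)).trans
      (h₁.trans (mul_le_mul_right (Metric.edist_le_ediam_of_mem (mem_univ _) (mem_univ _)) _))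
  have hle : ∀ n : ℕ, ∫⁻ x, Metric.infEDist x K ∂m ≤
      (s : ℝ≥0∞) ^ n * Metric.ediam (univ : Set X) := by
    intro n
    have hpos : lam ^ n ≠ 0 := by
      rw [← hmass n]
      intro h0
      rw [lintegral_eq_zero_iff (measurable_wordMass hf n)] at h0
      obtain ⟨x, hx⟩ := h0.exists
      exact (wordMass_pos n x).ne' hx
    have h₁ := hm.lintegral_ltransfer_iterate hf hp hdist n
    have h₂ : lam ^ n * ∫⁻ x, Metric.infEDist x K ∂m ≤
        lam ^ n * ((s : ℝ≥0∞) ^ n * Metric.ediam (univ : Set X)) := by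
      rw [← h₁, ← hmass n, mul_comm (∫⁻ x, wordMass f p n x ∂m), ← lintegral_const_mul]
      · exact lintegral_mono (hcontr n)
      · exact measurable_wordMass hf n
    exact (ENNReal.mul_le_mul_iff_right hpos (by finiteness)).1 h₂
  have hzero : ∫⁻ x, Metric.infEDist x K ∂m = 0 := by
    have hlim : Tendsto (fun n : ℕ => (s : ℝ≥0∞) ^ n * Metric.ediam (univ : Set X)) atTop
        (𝓝 (0 * Metric.ediam (univ : Set X))) :=
      ENNReal.Tendsto.mul_const
        (ENNReal.tendsto_pow_atTop_nhds_zero_of_lt_one (by exact_mod_cast hs)) (Or.inr hdiam)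
    rw [zero_mul] at hlim
    exact le_antisymm (ge_of_tendsto' hlim hle) zero_le
  rw [lintegral_eq_zero_iff hdist] at hzero
  filter_upwards [hzero] with x hx
  rw [Metric.mem_iff_infEDist_zero_of_closed h.isClosed]
  exact hx

end IsEigenmeasure

end IFS

/-- A pointwise limit of functions of the first `n` letters, the tail being replaced by zeros. -/
theorem IsHolder.measurable {β : ℝ} (hβ : 0 < β) {φ : (ℕ → ℕ) → ℝ} (h : IsHolder β φ) :
    Measurable φ := by
  obtain ⟨B, -, hB⟩ := h.exists_bound
  refine measurable_of_tendsto_metrizable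
    (fun n => measurable_comp_initialWord n fun w => φ (prepend w fun _ => 0))
    (tendsto_pi_nhds.2 fun ω => ?_)
  rw [tendsto_iff_dist_tendsto_zero]
  have hlim : Tendsto (fun n : ℕ => B * Real.exp (-β) ^ n) atTop (𝓝 (B * 0)) :=
    (tendsto_pow_atTop_nhds_zero_of_lt_one (Real.exp_nonneg _)
      (by rw [Real.exp_lt_one_iff]; linarith)).const_mul B
  rw [mul_zero] at hlim
  refine squeeze_zero' (Eventually.of_forall fun _ => dist_nonneg) ?_ hlim
  filter_upwards [eventually_ge_atTop 1] with n hn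
  rw [Real.dist_eq]
  refine hB n hn _ _ fun k hk => ?_
  have := prepend_mem_wordCylinder (initialWord ω n) (fun _ => 0) k (by rwa [initialWord_length])
  rwa [getElem_initialWord] at this

/-! ### Lifts of eigenmeasures -/

section IFS

variable {X : Type*} [MetricSpace X] [CompactSpace X] [Nonempty X] {f : ℕ → X → X} {s : ℝ≥0}
  {p : ℕ → C(X, ℝ)} {K : Set X} {D : ℝ} [MeasurableSpace X] [BorelSpace X] {m : Measure X}

theorem integrable_exp_wordSum [IsFiniteMeasure m] (hf : ∀ i, LipschitzWith s (f i)) (w : List ℕ)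
    (c : ℝ) : Integrable (fun x => Real.exp (wordSum f p w x - c)) m := by
  have := continuous_wordSum (p := p) hf w
  exact Continuous.integrable_of_hasCompactSupport (by fun_prop) (HasCompactSupport.of_compactSpace _)

/-- An eigenmeasure whose eigenvalue is the exponential of the pressure has a lift. -/
theorem IsEigenmeasure.exists_isLift (hm : IsEigenmeasure f p m)
    (hf : ∀ i, LipschitzWith s (f i))
    (hp : (⨆ x : X, ∑' i : ℕ, ENNReal.ofReal (Real.exp (p i x))) < ⊤)
    (hlam : ∫ x, transfer f p 1 x ∂m = Real.exp (pressure (potential f p))) :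
    ∃ ν : Measure (ℕ → ℕ), IsLift f p m ν := by
  have := hm.1
  set P := pressure (potential f p) with hP
  have hmeas : ∀ w : List ℕ,
      Measurable fun x => ENNReal.ofReal (Real.exp (wordSum f p w x - P * w.length)) := fun w => by
    have := (continuous_wordSum (p := p) hf w).measurable
    fun_prop
  obtain ⟨ν, hν, h⟩ := exists_measure_wordCylinder_eq
    (q := fun w => ∫⁻ x, ENNReal.ofReal (Real.exp (wordSum f p w x - P * w.length)) ∂m)
    (by simp [wordSum]) fun w => by
      -- Summing over a letter appended on the right applies the operator to the weight of `w`, so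
      -- consistency is the eigenvalue equation with eigenvalue `e^P`.
      have h₁ := hm.lintegral_ltransfer hf hp (hmeas w)
      rw [hlam] at h₁
      have h₂ : ∀ i, ∫⁻ x, ENNReal.ofReal
          (Real.exp (wordSum f p (w ++ [i]) x - P * (w ++ [i]).length)) ∂m =
          ENNReal.ofReal (Real.exp (-P)) * ∫⁻ x, ENNReal.ofReal (Real.exp (p i x)) *
            ENNReal.ofReal (Real.exp (wordSum f p w (f i x) - P * w.length)) ∂m := by
        intro i
        rw [← lintegral_const_mul']
        · refine lintegral_congr fun x => ?_
          rw [← ENNReal.ofReal_mul (Real.exp_nonneg _), ← ENNReal.ofReal_mul (Real.exp_nonneg _),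
            ← Real.exp_add, ← Real.exp_add, wordSum_append]
          congr 2
          simp only [wordSum, wordMap, List.length_append, List.length_singleton, Nat.cast_add,
            Nat.cast_one, Function.comp_apply, id]
          ring
        · exact ENNReal.ofReal_ne_top
      simp only [h₂]
      rw [ENNReal.tsum_mul_left, ← lintegral_tsum]
      · change _ = _ * ∫⁻ x, ltransfer f p
          (fun x => ENNReal.ofReal (Real.exp (wordSum f p w x - P * w.length))) x ∂m
        rw [h₁, ← mul_assoc, ← ENNReal.ofReal_mul (Real.exp_nonneg _), ← Real.exp_add]
        simp
      · intro i
        have h₃ := (hmeas w).comp (hf i).continuous.measurable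
        have h₄ := (p i).continuous.measurable
        exact Measurable.aemeasurable (Measurable.mul (by fun_prop) h₃)
  refine ⟨ν, hν, fun w => ?_⟩
  rw [measureReal_def, h w, integral_eq_lintegral_of_nonneg_ae
    (Eventually.of_forall fun x => Real.exp_nonneg _)
    (integrable_exp_wordSum hf w _).aestronglyMeasurable]

namespace IsLift

variable {ν : Measure (ℕ → ℕ)}

theorem measureReal_le (hν : IsLift f p m ν) [IsProbabilityMeasure m]
    (h : HasBoundedDistortion f p K D) (hf : ∀ i, LipschitzWith s (f i)) (hK : ∀ᵐ x ∂m, x ∈ K)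
    (w : List ℕ) {x : X} (hx : x ∈ K) : ν.real (wordCylinder w) ≤
      Real.exp D * Real.exp (wordSum f p w x - pressure (potential f p) * w.length) := by
  rw [hν.2 w]
  have h₁ := integral_mono_ae (integrable_exp_wordSum (m := m) (p := p) hf w
    (pressure (potential f p) * w.length)) (integrable_const (Real.exp D *
      Real.exp (wordSum f p w x - pressure (potential f p) * w.length))) (by
    filter_upwards [hK] with y hy
    rw [← Real.exp_add]
    exact Real.exp_le_exp.2 (by linarith [(abs_le.1 (h.abs_sub_le w y hy x hx)).2]))
  simpa using h₁

theorem le_measureReal (hν : IsLift f p m ν) [IsProbabilityMeasure m]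
    (h : HasBoundedDistortion f p K D) (hf : ∀ i, LipschitzWith s (f i)) (hK : ∀ᵐ x ∂m, x ∈ K)
    (w : List ℕ) {x : X} (hx : x ∈ K) :
    Real.exp (wordSum f p w x - pressure (potential f p) * w.length) ≤
      Real.exp D * ν.real (wordCylinder w) := by
  rw [hν.2 w, ← integral_const_mul]
  have h₁ := integral_mono_ae (integrable_const
    (Real.exp (wordSum f p w x - pressure (potential f p) * w.length)))
    ((integrable_exp_wordSum (m := m) (p := p) hf w
    (pressure (potential f p) * w.length)).const_mul (Real.exp D)) (by
    filter_upwards [hK] with y hy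
    rw [← Real.exp_add]
    exact Real.exp_le_exp.2 (by linarith [(abs_le.1 (h.abs_sub_le w x hx y hy)).2]))
  simpa using h₁

theorem measureReal_pos (hν : IsLift f p m ν) [IsProbabilityMeasure m]
    (h : HasBoundedDistortion f p K D) (hf : ∀ i, LipschitzWith s (f i)) (hK : ∀ᵐ x ∂m, x ∈ K)
    (w : List ℕ) : 0 < ν.real (wordCylinder w) := by
  have := hν.le_measureReal h hf hK w (h.codingMap_mem fun _ => 0)
  exact pos_of_mul_pos_right ((Real.exp_pos _).trans_le this) (Real.exp_nonneg _)

/-- The weight of `v ++ w` at `x` is the weight of `v` at `f_w x` times the weight of `w` at `x`.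
For `x ∈ K` the first factor is `ν[v]` up to `exp D`; integrate over `x`. -/
theorem isQuasiBernoulli (hν : IsLift f p m ν) [IsProbabilityMeasure m]
    (h : HasBoundedDistortion f p K D) (hf : ∀ i, LipschitzWith s (f i))
    (hK : ∀ᵐ x ∂m, x ∈ K) : IsQuasiBernoulli (Real.exp D).toNNReal ν := by
  have := hν.1
  set P := pressure (potential f p) with hP
  have hsplit : ∀ (v w : List ℕ) (x : X), Real.exp (wordSum f p (v ++ w) x - P * (v ++ w).length) =
      Real.exp (wordSum f p v (wordMap f w x) - P * v.length) *
        Real.exp (wordSum f p w x - P * w.length) := by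
    intro v w x
    rw [← Real.exp_add, wordSum_append, List.length_append]
    congr 1
    push_cast
    ring
  have hup : ∀ v w, ν.real (wordCylinder (v ++ w)) ≤
      Real.exp D * (ν.real (wordCylinder v) * ν.real (wordCylinder w)) := by
    intro v w
    rw [hν.2 (v ++ w), hν.2 w, ← mul_assoc, ← integral_const_mul]
    refine integral_mono_ae (integrable_exp_wordSum hf _ _)
      ((integrable_exp_wordSum hf w _).const_mul _) ?_
    filter_upwards [hK] with x hx
    rw [hsplit]
    exact mul_le_mul_of_nonneg_right
      (hν.le_measureReal h hf hK v (h.mapsTo_wordMap w hx)) (Real.exp_nonneg _)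
  have hlow : ∀ v w, ν.real (wordCylinder v) * ν.real (wordCylinder w) ≤
      Real.exp D * ν.real (wordCylinder (v ++ w)) := by
    intro v w
    rw [hν.2 (v ++ w), hν.2 w, ← integral_const_mul, ← integral_const_mul]
    refine integral_mono_ae ((integrable_exp_wordSum hf w _).const_mul _)
      ((integrable_exp_wordSum hf _ _).const_mul _) ?_
    filter_upwards [hK] with x hx
    rw [hsplit, ← mul_assoc]
    exact mul_le_mul_of_nonneg_right
      (hν.measureReal_le h hf hK v (h.mapsTo_wordMap w hx)) (Real.exp_nonneg _)
  refine ⟨hν.1, fun v w => ?_, fun v w => ?_⟩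
  · rw [← ENNReal.toReal_le_toReal (by finiteness) (by finiteness)]
    simpa [measureReal_def, (Real.exp_pos D).le] using hup v w
  · rw [← ENNReal.toReal_le_toReal (by finiteness) (by finiteness)]
    simpa [measureReal_def, (Real.exp_pos D).le] using hlow v w

/-- An invariant measure that is equivalent, up to a bounded factor, to the lift of an eigenmeasure
is a Gibbs measure. -/
theorem isGibbs (hν : IsLift f p m ν) [IsProbabilityMeasure m]
    (h : HasBoundedDistortion f p K D) (hs : s < 1) (hf : ∀ i, LipschitzWith s (f i))
    (hK : ∀ᵐ x ∂m, x ∈ K) {μ : Measure (ℕ → ℕ)} [IsProbabilityMeasure μ]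
    (hμν : μ ≤ (Real.exp D).toNNReal • ν) (hνμ : ν ≤ (Real.exp D).toNNReal • μ) :
    IsGibbs (potential f p) (pressure (potential f p)) (2 * D) μ := by
  have := hν.1
  have h₁ : ∀ w, μ.real (wordCylinder w) ≤ Real.exp D * ν.real (wordCylinder w) := by
    intro w
    have := ENNReal.toReal_mono (by
      rw [Measure.smul_apply, ENNReal.smul_def, smul_eq_mul]; finiteness) (hμν (wordCylinder w))
    rw [Measure.smul_apply, ENNReal.smul_def, smul_eq_mul] at this
    simpa [measureReal_def, (Real.exp_pos D).le] using this
  have h₂ : ∀ w, ν.real (wordCylinder w) ≤ Real.exp D * μ.real (wordCylinder w) := by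
    intro w
    have := ENNReal.toReal_mono (by
      rw [Measure.smul_apply, ENNReal.smul_def, smul_eq_mul]; finiteness) (hνμ (wordCylinder w))
    rw [Measure.smul_apply, ENNReal.smul_def, smul_eq_mul] at this
    simpa [measureReal_def, (Real.exp_pos D).le] using this
  have hpos : ∀ w, 0 < μ.real (wordCylinder w) := fun w =>
    pos_of_mul_pos_right ((hν.measureReal_pos h hf hK w).trans_le (h₂ w)) (Real.exp_nonneg _)
  refine ⟨hpos, fun n ω => ?_⟩
  have hS := wordSum_codingMap (p := p) hs hf (initialWord ω n) (shift^[n] ω)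
  rw [prepend_initialWord_shift, initialWord_length] at hS
  have hx := h.codingMap_mem (shift^[n] ω)
  have h₃ := hν.measureReal_le h hf hK (initialWord ω n) hx
  have h₄ := hν.le_measureReal h hf hK (initialWord ω n) hx
  rw [hS, initialWord_length] at h₃ h₄
  set S := ∑ j ∈ Finset.range n, potential f p (shift^[j] ω)
  -- One `D` passes from `μ` to `ν`, the other from `ν` to the exponential of the Birkhoff sum.
  have h₅ : μ.real (wordCylinder (initialWord ω n)) ≤
      Real.exp (2 * D + (S - pressure (potential f p) * n)) := by
    refine (h₁ _).trans ((mul_le_mul_of_nonneg_left h₃ (Real.exp_nonneg _)).trans_eq ?_)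
    rw [← Real.exp_add, ← Real.exp_add]
    congr 1
    ring
  have h₆ : Real.exp (-(2 * D) + (S - pressure (potential f p) * n)) ≤
      μ.real (wordCylinder (initialWord ω n)) := by
    rw [Real.exp_add, Real.exp_neg, inv_mul_le_iff₀ (Real.exp_pos _)]
    refine h₄.trans ((mul_le_mul_of_nonneg_left (h₂ _) (Real.exp_nonneg _)).trans_eq ?_)
    rw [← mul_assoc, ← Real.exp_add, two_mul]
  have h₇ := Real.log_le_log (hpos _) h₅
  have h₈ := Real.log_le_log (Real.exp_pos _) h₆
  rw [Real.log_exp] at h₇ h₈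
  rw [info, abs_le]
  constructor <;> linarith

/-- On `[i]` the potential, and up to sign both infima, are within `D` of `p i x`, while `ν[i]` is
at most a constant times `exp (p i x)`. So the integral of `|φ|` is dominated by the series of the
hypothesis and that of `exp (p i x)`. -/
theorem integrable_potential (hν : IsLift f p m ν) [IsProbabilityMeasure m]
    (h : HasBoundedDistortion f p K D) (hf : ∀ i, LipschitzWith s (f i))
    (hK : ∀ᵐ x ∂m, x ∈ K)
    (hp : (⨆ x : X, ∑' i : ℕ, ENNReal.ofReal (Real.exp (p i x))) < ⊤)
    (hmeas : Measurable (potential f p))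
    (hsum : Summable fun i : ℕ =>
      sInf ((fun ω => -potential f p ω) '' wordCylinder [i]) *
        Real.exp (sInf (potential f p '' wordCylinder [i]))) :
    Integrable (potential f p) ν := by
  have := hν.1
  have hx := h.codingMap_mem fun _ => 0
  set x := codingMap f fun _ => 0
  have hosc : ∀ i, ∀ ω ∈ wordCylinder [i], |potential f p ω - p i x| ≤ D := by
    intro i ω hω
    rw [wordCylinder_singleton_eq] at hω
    rw [potential, show ω 0 = i from hω]
    exact h.abs_sub_le_letter i (h.codingMap_mem _) hx
  have hne : ∀ i, (wordCylinder [i]).Nonempty := fun i =>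
    ⟨_, prepend_mem_wordCylinder [i] fun _ => 0⟩
  have hinf : ∀ (g : (ℕ → ℕ) → ℝ) (i : ℕ) (c : ℝ), (∀ ω ∈ wordCylinder [i], |g ω - c| ≤ D) →
      |sInf (g '' wordCylinder [i]) - c| ≤ D := by
    intro g i c hg
    obtain ⟨ω, hω⟩ := hne i
    rw [abs_le]
    constructor
    · have : c - D ≤ sInf (g '' wordCylinder [i]) := le_csInf ((hne i).image g) (by
        rintro _ ⟨ω, hω, rfl⟩
        linarith [(abs_le.1 (hg ω hω)).1])
      linarith
    · have : sInf (g '' wordCylinder [i]) ≤ g ω := csInf_le ⟨c - D, by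
        rintro _ ⟨ω, hω, rfl⟩
        linarith [(abs_le.1 (hg ω hω)).1]⟩ (mem_image_of_mem g hω)
      linarith [(abs_le.1 (hg ω hω)).2]
  have hi₁ := fun i => hinf (potential f p) i (p i x) (hosc i)
  have hi₂ := fun i => hinf (fun ω => -potential f p ω) i (-p i x) fun ω hω => by
    rw [neg_sub_neg, abs_sub_comm]
    exact hosc i ω hω
  have hexp := summable_exp hp x
  have hbase : Summable fun i => (|p i x| + D) * Real.exp (p i x) := by
    -- A real summable series is absolutely summable, so the sign of the infimum of `-φ` does not
    -- matter.
    have hmaj := (hsum.abs.mul_left (Real.exp D)).add (hexp.mul_left (2 * D))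
    refine hmaj.of_nonneg_of_le
      (fun i => mul_nonneg (add_nonneg (abs_nonneg _) h.nonneg) (Real.exp_nonneg _)) fun i => ?_
    set a := sInf ((fun ω => -potential f p ω) '' wordCylinder [i])
    set b := sInf (potential f p '' wordCylinder [i])
    have ha : |p i x| ≤ |a| + D := by
      have h₁ := abs_sub_abs_le_abs_sub (-p i x) a
      rw [abs_neg, abs_sub_comm] at h₁
      linarith [hi₂ i]
    have hb : Real.exp (p i x) ≤ Real.exp D * Real.exp b := by
      rw [← Real.exp_add]
      exact Real.exp_le_exp.2 (by linarith [(abs_le.1 (hi₁ i)).1])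
    rw [abs_mul, Real.abs_exp]
    calc (|p i x| + D) * Real.exp (p i x) ≤ (|a| + D + D) * Real.exp (p i x) := by gcongr
      _ = |a| * Real.exp (p i x) + 2 * D * Real.exp (p i x) := by ring
      _ ≤ |a| * (Real.exp D * Real.exp b) + 2 * D * Real.exp (p i x) := by gcongr
      _ = _ := by ring
  refine ⟨hmeas.aestronglyMeasurable, ?_⟩
  rw [hasFiniteIntegral_iff_norm]
  have hU : (univ : Set (ℕ → ℕ)) = ⋃ i : ℕ, wordCylinder [i] := by
    ext ω
    simp [wordCylinder_singleton_eq]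
  rw [← setLIntegral_univ, hU]
  refine (lintegral_iUnion_le _ _).trans_lt ?_
  have hpiece : ∀ i, ∫⁻ ω in wordCylinder [i], ENNReal.ofReal ‖potential f p ω‖ ∂ν ≤
      ENNReal.ofReal (Real.exp D * Real.exp (-pressure (potential f p)) *
        ((|p i x| + D) * Real.exp (p i x))) := by
    intro i
    calc ∫⁻ ω in wordCylinder [i], ENNReal.ofReal ‖potential f p ω‖ ∂ν
        ≤ ∫⁻ _ω in wordCylinder [i], ENNReal.ofReal (|p i x| + D) ∂ν := by
          refine setLIntegral_mono measurable_const fun ω hω => ENNReal.ofReal_le_ofReal ?_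
          have := abs_sub_abs_le_abs_sub (potential f p ω) (p i x)
          rw [Real.norm_eq_abs]
          linarith [hosc i ω hω]
      _ = ENNReal.ofReal (|p i x| + D) * ν (wordCylinder [i]) := setLIntegral_const _ _
      _ = ENNReal.ofReal ((|p i x| + D) * ν.real (wordCylinder [i])) := by
          rw [ENNReal.ofReal_mul (add_nonneg (abs_nonneg _) h.nonneg), ofReal_measureReal]
      _ ≤ _ := by
          refine ENNReal.ofReal_le_ofReal ?_
          have h₁ := hν.measureReal_le h hf hK [i] hx
          have h₂ : wordSum f p [i] x - pressure (potential f p) * ([i] : List ℕ).length =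
              -pressure (potential f p) + p i x := by
            simp [wordSum, wordMap]
            ring
          rw [h₂, Real.exp_add] at h₁
          calc _ ≤ _ := mul_le_mul_of_nonneg_left h₁ (add_nonneg (abs_nonneg _) h.nonneg)
            _ = _ := by ring
  refine (ENNReal.tsum_le_tsum hpiece).trans_lt ?_
  exact (hbase.mul_left _).tsum_ofReal_lt_top

end IsLift

end IFS

end CountableShift

/-! ### The theorem -/

open CountableShift in
theorem theorem3p2 {X : Type*} [MetricSpace X] [CompactSpace X] [Nonempty X]
    [MeasurableSpace X] [BorelSpace X]
    (f : ℕ → X → X) (s : ℝ≥0) (hs : s < 1) (hf : ∀ i, LipschitzWith s (f i))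
    (p : ℕ → C(X, ℝ))
    (hp : (⨆ x : X, ∑' i : ℕ, ENNReal.ofReal (Real.exp (p i x))) < ⊤)
    (β : ℝ) (hβ : 0 < β) (hφ : IsHolder β (potential f p))
    (hsum : Summable fun i : ℕ =>
      sInf ((fun ω => -potential f p ω) '' wordCylinder [i]) *
        Real.exp (sInf (potential f p '' wordCylinder [i]))) :
    Tendsto (pressureSeq (potential f p)) atTop (𝓝 (pressure (potential f p) : EReal)) ∧
    (∃ μ : Measure (ℕ → ℕ), IsInvariantGibbs f p μ) ∧
    ∀ μ : Measure (ℕ → ℕ), IsInvariantGibbs f p μ →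
      Integrable (potential f p) μ ∧
      ksEntropy shift μ + ((∫ ω, potential f p ω ∂μ : ℝ) : EReal) =
        (pressure (potential f p) : EReal) := by
  obtain ⟨K, D, h⟩ := exists_hasBoundedDistortion (p := p) hs hf hβ hφ
  refine ⟨h.tendsto_pressureSeq hs hf hp, ?_, ?_⟩
  · obtain ⟨m, hm, hlam⟩ := h.exists_isEigenmeasure hs hf hp
    obtain ⟨ν, hν⟩ := hm.exists_isLift hf hp hlam
    have := hm.1
    obtain ⟨μ, hμ, herg, hμν, -⟩ :=
      (hν.isQuasiBernoulli h hf (hm.ae_mem h hs hf hp)).exists_ergodic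
    exact ⟨μ, hμ, herg, m, ν, hm, hν, Measure.absolutelyContinuous_of_le_smul hμν⟩
  · rintro μ ⟨hμ, herg, m, ν, hm, hν, hac⟩
    have := hm.1
    have hK := hm.ae_mem h hs hf hp
    obtain ⟨μ₀, hμ₀, herg₀, hμν, hνμ⟩ := (hν.isQuasiBernoulli h hf hK).exists_ergodic
    have hinv : MeasurePreserving shift μ μ := (herg 1 le_rfl).toMeasurePreserving
    -- An invariant probability measure absolutely continuous with respect to an ergodic one equals
    -- it. This upgrades `μ ≪ ν` to two-sided bounds between `μ` and `ν`.
    obtain rfl : μ = μ₀ := (herg₀ 1 le_rfl).eq_of_absolutelyContinuous hinv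
      (hac.trans (Measure.absolutelyContinuous_of_le_smul hνμ))
    have hint : Integrable (potential f p) μ :=
      ((hν.integrable_potential h hf hK hp (hφ.measurable hβ) hsum).smul_measure
        ENNReal.coe_ne_top).mono_measure hμν
    refine ⟨hint, ?_⟩
    rw [(hν.isGibbs h hs hf hK hμν hνμ).ksEntropy_eq hinv hint, ← EReal.coe_add, sub_add_cancel]
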